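/- Fix $N\ge 0$. Consider $2d$ massless QED with gauge group $U(1)^N$, photon kinetic term $\tfrac12\sum_{a,b}\kappa_{ab}\,\mathrm da_a\wedge\star\mathrm da_b$ with $\kappa=g^{-2}$ a real symmetric positive definite matrix, and $N$ complex Weyl fermions of each chirality, the $I$-th left-mover (right-mover) having integer charge $(Q_\ell)_{Ia}$ (resp. $(Q_r)_{Ia}$) under the $a$-th $U(1)$, with cancelled gauge anomaly $Q_\ell^tQ_\ell=Q_r^tQ_r$. The non-chiral system with charge matrix $Q$ is the case $Q_\ell=Q_r=Q$. For each chirality, with charge matrix $Q$, quantize in light-cone gauge on a longitudinal circle of circumference $2\pi$. The Hilbert space is the Fock space of $N$ complex fermions $\psi^I(x)=(2\pi)^{-1/2}\sum_{k\in\mathbb Z}\psi^I_k e^{-i(k+1/2)x}$ with vacuum $|0\rangle$; its number currents are $j^I={:}\psi^{I\dagger}\psi^I{:}$ with modes $j^I_n$, and its gauge currents $J_{a,n}=\sum_I Q_{Ia}j^I_n$. Physical (gauge-invariant) states satisfy $J_{a,0}\Psi=0$ for all $a$. The light-cone energy, momentum and squared mass are $$P^-=\frac1{2\pi}\sum_{n\ge1}\frac1{n^2}\sum_{a,b}(\kappa^{-1})_{ab}J_{a,-n}J_{b,n},\qquad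 P^+=\sum_{I,k}(k+\tfrac12){:}\psi^{I\dagger}_k\psi^I_k{:},\qquad M^2=2P^+P^- .$$ The theory is *gapped* if, for both chiralities, there is $\Delta>0$ with $\langle\Psi,M^2\Psi\rangle\ge\Delta\|\Psi\|^2$ for all gauge-invariant Fock states $\Psi\perp|0\rangle$. A *massless state* is a gauge-invariant $\Psi\notin\mathbb C|0\rangle$ with $P^-\Psi=0$. Let $K=Q^tQ$. The current algebra $U(1)_K$ *embeds conformally* into $U(N)_1$ if $[J_{a,m},J_{b,n}]=m\,K_{ab}\,\delta_{m+n,0}$ and the Sugawara energy-momentum tensor $\tfrac12\sum_{a,b}(K^{-1})_{ab}{:}J_aJ_b{:}$ equals the energy-momentum tensor $\tfrac12\sum_I({:}\partial\psi^{I\dagger}\psi^I{:}-{:}\psi^{I\dagger}\partial\psi^I{:})$ of the fermions (equality of all modes $L_n$ as operators). If $K$ is singular, $K^{-1}$ denotes the inverse on the orthogonal complement of $\ker K$, extended by $0$ (the currents in the directions of $\ker K$ vanish). The central charge $c$ of an energy-momentum tensor with modes $L_n$ is defined by $\langle0|L_2L_{-2}|0\rangle=c/2$. **Lemma.** (1)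 For every $Q\in M_N(\mathbb Z)$ the following are equivalent: the non-chiral QED system defined by $Q$ is gapped; it has no massless states; $U(1)_{Q^tQ}$ embeds conformally into $U(N)_1$; $Q$ has full rank $N$. The central charge of the free fermions is $N$ and that of $U(1)_{Q^tQ}$ is $\operatorname{rank}Q$. (2) For all $Q_\ell,Q_r\in M_N(\mathbb Z)$ with $Q_\ell^tQ_\ell=Q_r^tQ_r$ one has $\operatorname{rank}Q_\ell=\operatorname{rank}Q_r$, and the following are equivalent: the chiral QED system defined by $(Q_\ell,Q_r)$ is gapped; it has no massless states of either chirality; both $U(1)_{Q_\ell^tQ_\ell}$ and $U(1)_{Q_r^tQ_r}$ embed conformally into $U(N)_1$ (through the left- and right-moving currents); $Q_\ell$ and $Q_r$ have full rank $N$. -/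

import Mathlib

open scoped Matrix ComplexConjugate

noncomputable section

namespace QED

/-! ### The Fock space of `N` chiral complex (Weyl) fermions on a circle

The longitudinal light-cone coordinate is a circle of circumference `2π`, with antiperiodic
fermions, so that `ψ^I(x) = (2π)^(-1/2) ∑_k ψ^I_k exp (-i (k + 1/2) x)`, `k ∈ ℤ`.  For `k ≥ 0` the
mode `ψ^I_k` annihilates a particle of momentum `k + 1/2`; for `k < 0` it creates an antiparticle
of momentum `-(k + 1/2)`. -/

/-- One-particle modes: a flavour `I` and an integer `k` (momentum `|k + 1/2|`; particles for
`0 ≤ k`, antiparticles for `k < 0`).  The lexicographic order only fixes the fermionic signs. -/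
abbrev Mode (N : ℕ) : Type := Fin N ×ₗ ℤ

/-- The (algebraic) Fock space: finite complex combinations of the occupation-number states. -/
abbrev Fock (N : ℕ) : Type := Finset (Mode N) →₀ ℂ

/-- Linear operators on the Fock space. -/
abbrev Op (N : ℕ) : Type := Module.End ℂ (Fock N)

variable {N : ℕ}

/-- The state in which exactly the modes in `S` are occupied. -/
def ket (S : Finset (Mode N)) : Fock N := Finsupp.single S 1

/-- The Fock vacuum. -/
def vacuum (N : ℕ) : Fock N := ket ∅

/-- The inner product for which the occupation-number states are orthonormal. -/
def fockInner (Φ Ψ : Fock N) : ℂ := Φ.sum fun S c => conj c * Ψ S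

/-- The fermionic sign: the parity of the number of occupied modes before `m`. -/
def fermiSign (m : Mode N) (S : Finset (Mode N)) : ℂ := (-1) ^ (S.filter (· < m)).card

/-- The annihilation operator of the mode `m`. -/
def annihilate (m : Mode N) : Op N :=
  Finsupp.linearCombination ℂ fun S =>
    if m ∈ S then fermiSign m S • ket (S.erase m) else 0

/-- The creation operator of the mode `m`. -/
def create (m : Mode N) : Op N :=
  Finsupp.linearCombination ℂ fun S =>
    if m ∈ S then 0 else fermiSign m S • ket (insert m S)

/-- The Fourier mode `ψ^I_k` of the fermion field. -/
def psi (I : Fin N) (k : ℤ) : Op N :=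
  if 0 ≤ k then annihilate (toLex (I, k)) else create (toLex (I, k))

/-- The adjoint `(ψ^I_k)†` of the mode `ψ^I_k`. -/
def psiDag (I : Fin N) (k : ℤ) : Op N :=
  if 0 ≤ k then create (toLex (I, k)) else annihilate (toLex (I, k))

/-- The fermion normal-ordered product `:(ψ^I_k)† ψ^I_l:` (annihilators to the right). -/
def normalOrd (I : Fin N) (k l : ℤ) : Op N :=
  if 0 ≤ l then psiDag I k * psi I l else -(psi I l * psiDag I k)

/-- The sum of a family of operators of which only finitely many act nontrivially on each
occupation-number state. -/
def locSum {ι : Type} (A : ι → Op N) : Op N :=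
  Finsupp.linearCombination ℂ fun S => ∑ᶠ i, A i (ket S)

/-- The mode `j^I_n` of the number current `:ψ^I† ψ^I:` of the `I`-th fermion. -/
def current (I : Fin N) (n : ℤ) : Op N := locSum fun k : ℤ => normalOrd I k (k + n)

/-- The modes `L_n` of the canonical energy-momentum tensor
`T = (1/2) ∑_I (:∂ψ^I† ψ^I: - :ψ^I† ∂ψ^I:)` of the free fermions, i.e. of `U(N)_1`. -/
def fermionT (N : ℕ) (n : ℤ) : Op N :=
  ∑ I : Fin N, locSum fun k : ℤ => ((k : ℂ) + 1 / 2 + (n : ℂ) / 2) • normalOrd I k (k + n)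

/-! ### The gauge currents and the light-cone Hamiltonian

`Q I a` is the charge of the `I`-th fermion under the `a`-th factor of the gauge group `U(1)^C`. -/

variable {C : ℕ}

/-- The mode `J_{a,n}` of the gauge current `J_a = ∑_I Q_{Ia} :ψ^I† ψ^I:`. -/
def gaugeCurrent (Q : Matrix (Fin N) (Fin C) ℤ) (a : Fin C) (n : ℤ) : Op N :=
  ∑ I : Fin N, (Q I a : ℂ) • current I n

/-- Gauge-invariant states: those annihilated by the total gauge charges. -/
def GaugeInvariant (Q : Matrix (Fin N) (Fin C) ℤ) (Ψ : Fock N) : Prop :=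
  ∀ a, gaugeCurrent Q a 0 Ψ = 0

/-- The light-cone Hamiltonian `-(1/2) ∑_{a,b} (g²)_{ab} ∫ dx :J_a ∂⁻² J_b:` on gauge-invariant
states, in Fourier modes.  Here `κ = g⁻²` is the matrix of the photon kinetic term. -/
def lightconeEnergy (κ : Matrix (Fin C) (Fin C) ℝ) (Q : Matrix (Fin N) (Fin C) ℤ) : Op N :=
  (1 / (2 * (Real.pi : ℂ))) • locSum fun n : ℕ =>
    (1 / ((n : ℂ) + 1) ^ 2) • ∑ a : Fin C, ∑ b : Fin C,
      ((κ⁻¹ a b : ℝ) : ℂ) • (gaugeCurrent Q a (-((n : ℤ) + 1)) * gaugeCurrent Q b ((n : ℤ) + 1))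

/-- The longitudinal momentum `∑_I ∑_k (k + 1/2) :(ψ^I_k)† ψ^I_k:`. -/
def longitudinalMomentum (N : ℕ) : Op N := fermionT N 0

/-- The mass-squared operator `M² = 2 P⁺ P⁻`. -/
def massSq (κ : Matrix (Fin C) (Fin C) ℝ) (Q : Matrix (Fin N) (Fin C) ℤ) : Op N :=
  (2 : ℂ) • (longitudinalMomentum N * lightconeEnergy κ Q)

/-- Mass gap for one light-cone quantization (the movers of one chirality, with charges `Q`):
above the vacuum, `M²` is bounded below by a positive constant on the gauge-invariant states. -/
def ChiralGapped (κ : Matrix (Fin C) (Fin C) ℝ) (Q : Matrix (Fin N) (Fin C) ℤ) : Prop :=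
  ∃ Δ : ℝ, 0 < Δ ∧ ∀ Ψ : Fock N, GaugeInvariant Q Ψ → fockInner (vacuum N) Ψ = 0 →
    Δ * (fockInner Ψ Ψ).re ≤ (fockInner Ψ (massSq κ Q Ψ)).re

/-- The QED system with photon kinetic matrix `κ`, charges `Ql` of the left-movers and `Qr` of the
right-movers is gapped: both light-cone quantizations have a mass gap.  The non-chiral system with
charge matrix `Q` is the case `Ql = Qr = Q`. -/
def Gapped (κ : Matrix (Fin C) (Fin C) ℝ) (Ql Qr : Matrix (Fin N) (Fin C) ℤ) : Prop :=
  ChiralGapped κ Ql ∧ ChiralGapped κ Qr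

/-- There is a massless particle of the given chirality: a gauge-invariant state of zero light-cone
energy other than the vacuum. -/
def HasMasslessState (κ : Matrix (Fin C) (Fin C) ℝ) (Q : Matrix (Fin N) (Fin C) ℤ) : Prop :=
  ∃ Ψ : Fock N, GaugeInvariant Q Ψ ∧ lightconeEnergy κ Q Ψ = 0 ∧ ∀ c : ℂ, Ψ ≠ c • vacuum N

/-! ### The current algebra `U(1)_K`, `K = QᵗQ`, and its energy-momentum tensor -/

/-- The charge matrix with real entries. -/
def realCharge (Q : Matrix (Fin N) (Fin C) ℤ) : Matrix (Fin N) (Fin C) ℝ :=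
  Q.map fun z : ℤ => (z : ℝ)

/-- The matrix of levels `K = QᵗQ`. -/
def level (Q : Matrix (Fin N) (Fin C) ℤ) : Matrix (Fin C) (Fin C) ℝ :=
  (realCharge Q)ᵀ * realCharge Q

theorem level_isHermitian (Q : Matrix (Fin N) (Fin C) ℤ) : (level Q).IsHermitian := by
  simp [level, Matrix.IsHermitian, Matrix.conjTranspose_eq_transpose_of_trivial]

/-- The inverse of `K` on the span of its eigenvectors with nonzero eigenvalue, and zero on its
kernel (the Moore-Penrose inverse); `K⁻¹` when `K` is nonsingular.  Indeed `0⁻¹ = 0` here, so that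
the factors `U(1)_0`, whose currents vanish, do not contribute. -/
def levelInv (Q : Matrix (Fin N) (Fin C) ℤ) : Matrix (Fin C) (Fin C) ℝ :=
  ((level_isHermitian Q).eigenvectorUnitary : Matrix (Fin C) (Fin C) ℝ) *
    Matrix.diagonal (fun i => ((level_isHermitian Q).eigenvalues i)⁻¹) *
    ((level_isHermitian Q).eigenvectorUnitary : Matrix (Fin C) (Fin C) ℝ)ᵀ

/-- The normal-ordered product `:J_{a,m} J_{b,l}:` (the larger mode number to the right). -/
def currentOrd (Q : Matrix (Fin N) (Fin C) ℤ) (a b : Fin C) (m l : ℤ) : Op N :=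
  if m ≤ l then gaugeCurrent Q a m * gaugeCurrent Q b l
  else gaugeCurrent Q b l * gaugeCurrent Q a m

/-- The modes of the Sugawara energy-momentum tensor `(1/2) ∑_{a,b} (K⁻¹)_{ab} :J_a J_b:`. -/
def sugawaraT (Q : Matrix (Fin N) (Fin C) ℤ) (n : ℤ) : Op N :=
  (1 / 2 : ℂ) • ∑ a : Fin C, ∑ b : Fin C,
    ((levelInv Q a b : ℝ) : ℂ) • locSum fun m : ℤ => currentOrd Q a b m (n - m)

/-- `U(1)_{QᵗQ}` embeds conformally into `U(N)_1`: the gauge currents, which are bilinear in the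
fermions, obey the current algebra of level `K = QᵗQ`, and their Sugawara energy-momentum tensor is
that of the fermions. -/
def ConformallyEmbeds (Q : Matrix (Fin N) (Fin C) ℤ) : Prop :=
  (∀ (a b : Fin C) (m n : ℤ),
    gaugeCurrent Q a m * gaugeCurrent Q b n - gaugeCurrent Q b n * gaugeCurrent Q a m =
      (if m + n = 0 then (m : ℂ) * ((level Q a b : ℝ) : ℂ) else 0) • (1 : Op N)) ∧
  ∀ n : ℤ, sugawaraT Q n = fermionT N n

/-- The central charge `c` of an energy-momentum tensor with modes `L_n`, read off from its vacuum
two-point function, `⟨T(z) T(0)⟩ = (c/2) z⁻⁴`, i.e. `⟨0| L_2 L_{-2} |0⟩ = c/2`. -/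
def centralCharge (L : ℤ → Op N) : ℂ := 2 * fockInner (vacuum N) (L 2 (L (-2) (vacuum N)))

/-! ### All the sums above are locally finite -/

theorem annihilate_ket (m : Mode N) (S : Finset (Mode N)) :
    annihilate m (ket S) = if m ∈ S then fermiSign m S • ket (S.erase m) else 0 := by
  simp [annihilate, ket]

theorem exists_bound (S : Finset (Mode N)) :
    ∃ B : ℤ, ∀ (I : Fin N) (k : ℤ), toLex (I, k) ∈ S → |k| ≤ B := by
  obtain ⟨B, hB⟩ := (S.image fun m => |(ofLex m).2|).bddAbove
  exact ⟨B, fun I k h => hB (by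
    simp only [Finset.coe_image, Set.mem_image, Finset.mem_coe]
    exact ⟨_, h, rfl⟩)⟩

theorem normalOrd_ket_bounds {S : Finset (Mode N)} {B : ℤ}
    (hB : ∀ (I : Fin N) (k : ℤ), toLex (I, k) ∈ S → |k| ≤ B) {I : Fin N} {k l : ℤ}
    (h : normalOrd I k l (ket S) ≠ 0) :
    (0 ≤ l ∧ l ≤ B ∧ (-B ≤ k ∨ 0 ≤ k)) ∨ (l < 0 ∧ (-B ≤ k ∨ 0 ≤ k)) := by
  by_cases hl : 0 ≤ l
  · left
    simp only [normalOrd, hl, if_true, Module.End.mul_apply, psi, annihilate_ket] at h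
    by_cases hm : toLex (I, l) ∈ S
    · refine ⟨hl, (le_abs_self l).trans (hB I l hm), ?_⟩
      by_contra! hk
      have hk0 : ¬ 0 ≤ k := by omega
      have hkS : toLex (I, k) ∉ S.erase (toLex (I, l)) := fun hc => by
        have := hB I k (Finset.mem_of_mem_erase hc)
        rw [abs_le] at this
        omega
      simp [hm, psiDag, hk0, annihilate_ket, hkS] at h
    · simp [hm] at h
  · right
    refine ⟨by omega, ?_⟩
    by_contra! hk
    have hk0 : ¬ 0 ≤ k := by omega
    have hkS : toLex (I, k) ∉ S := fun hc => by
      have := hB I k hc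
      rw [abs_le] at this
      omega
    simp [normalOrd, hl, Module.End.mul_apply, psiDag, hk0, annihilate_ket, hkS] at h

theorem normalOrd_locallyFinite (I : Fin N) (n : ℤ) (S : Finset (Mode N)) :
    {k : ℤ | normalOrd I k (k + n) (ket S) ≠ 0}.Finite := by
  obtain ⟨B, hB⟩ := exists_bound S
  refine (Set.finite_Icc (-|B| - |n|) (|B| + |n|)).subset fun k hk => ?_
  have h1 := abs_le.mp (le_refl |B|)
  have h2 := abs_le.mp (le_refl |n|)
  rcases normalOrd_ket_bounds hB hk with h | h <;> constructor <;> omega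

/-- Every state is annihilated by all current modes of sufficiently high mode number. -/
theorem exists_current_ket_eq_zero (S : Finset (Mode N)) :
    ∃ B : ℤ, 0 ≤ B ∧ ∀ (I : Fin N) (n : ℤ), B < n → current I n (ket S) = 0 := by
  obtain ⟨B, hB⟩ := exists_bound S
  have h1 := abs_le.mp (le_refl |B|)
  refine ⟨2 * |B|, by positivity, fun I n hn => ?_⟩
  have : ∀ k : ℤ, normalOrd I k (k + n) (ket S) = 0 := fun k => by
    by_contra hk
    rcases normalOrd_ket_bounds hB hk with h | h <;> omega
  have hz : current I n (ket S) = ∑ᶠ k : ℤ, normalOrd I k (k + n) (ket S) := by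
    simp only [current, locSum]
    rw [ket, Finsupp.linearCombination_single, one_smul]
    rfl
  rw [hz]
  simp [this]

theorem exists_gaugeCurrent_ket_eq_zero (Q : Matrix (Fin N) (Fin C) ℤ) (S : Finset (Mode N)) :
    ∃ B : ℤ, 0 ≤ B ∧ ∀ (a : Fin C) (n : ℤ), B < n → gaugeCurrent Q a n (ket S) = 0 := by
  obtain ⟨B, hB0, hB⟩ := exists_current_ket_eq_zero S
  exact ⟨B, hB0, fun a n hn => by simp [gaugeCurrent, hB _ n hn]⟩

theorem currentOrd_locallyFinite (Q : Matrix (Fin N) (Fin C) ℤ) (a b : Fin C) (n : ℤ)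
    (S : Finset (Mode N)) : {m : ℤ | currentOrd Q a b m (n - m) (ket S) ≠ 0}.Finite := by
  obtain ⟨B, hB0, hB⟩ := exists_gaugeCurrent_ket_eq_zero Q S
  have h2 := abs_le.mp (le_refl |n|)
  refine (Set.finite_Icc (-B - |n|) (B + |n|)).subset fun m hm => ?_
  by_contra hc
  apply hm
  rw [Set.mem_Icc, not_and_or] at hc
  by_cases h : m ≤ n - m
  · simp only [currentOrd, h, if_true, Module.End.mul_apply]
    rw [hB b (n - m) (by omega), map_zero]
  · simp only [currentOrd, h, if_false, Module.End.mul_apply]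
    rw [hB a m (by omega), map_zero]

theorem lightcone_locallyFinite (κ : Matrix (Fin C) (Fin C) ℝ) (Q : Matrix (Fin N) (Fin C) ℤ)
    (S : Finset (Mode N)) :
    {n : ℕ | ((1 / ((n : ℂ) + 1) ^ 2) • ∑ a : Fin C, ∑ b : Fin C,
      ((κ⁻¹ a b : ℝ) : ℂ) • (gaugeCurrent Q a (-((n : ℤ) + 1)) *
        gaugeCurrent Q b ((n : ℤ) + 1)) : Op N) (ket S) ≠ 0}.Finite := by
  obtain ⟨B, hB0, hB⟩ := exists_gaugeCurrent_ket_eq_zero Q S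
  refine (Set.finite_Iic B.toNat).subset fun n hn => ?_
  by_contra hc
  apply hn
  have : B < (n : ℤ) + 1 := by
    rw [Set.mem_Iic] at hc
    omega
  simp [hB _ _ this]

end QED

end

/-! Each condition is compared with full rank of the charge matrix, one chirality at a time. The
engine is abelian bosonization: the number currents satisfy [j^I_m, j^J_n] = m δ_IJ δ_{m+n,0}
(`current_commutator`), and the canonical energy-momentum tensor is (1/2) ∑_I :j^I j^I:
(`quadraticT_one_eq`). The second fact rests on `hasLocSum_currentPsi`: the modes of the product of
j^I and ψ^I are multiples of those of ψ^I. Hence both tensors have the same commutators with the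
fermions, and an operator that commutes with all fermion modes and kills the vacuum is zero
(`eq_zero_of_commute`).

Conformal embedding: the Sugawara tensor of the gauge currents is (1/2) ∑ P_IJ :j^I j^J: with P = Q
K⁻¹ Qᵗ, the orthogonal projection onto the column space of Q, and its central charge is tr P² = rank
Q. Equal tensors have equal central charges, so an embedding forces rank N; conversely rank N gives
P = 1, and bosonization concludes.

Mass gap: at full rank, gauge invariance forces every j^I_0 to vanish. On such a state of momentum
p, bosonization gives p‖Ψ‖² = ∑_{n≥1} ∑_I ‖j^I_n Ψ‖², where only n ≤ p contribute. The light-cone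
energy is the analogous sum with weights 1/(2πn²) and the form Q κ⁻¹ Qᵗ, which is bounded below by
some c > 0. As 1/n² ≥ 1/p², P⁻ is at least c/(2πp); the momentum cancels in M² = 2P⁺P⁻ ≥ c/π,
uniformly in p (`lightconeEnergy_bound`).

Massless states: if vQ = 0 with v ≠ 0, the current ∑ v_J j^J commutes with all gauge currents, and
its mode -1 applied to the vacuum is massless (`exists_massless`). A gap excludes massless states,
which closes the equivalences. -/

noncomputable section

namespace QED

variable {N : ℕ} {C : ℕ}

/-- The ring of operators, with the negation and subtraction of linear maps. -/
instance opRing : Ring (Op N) :=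
  { (inferInstance : Semiring (Op N)) with
    neg := Neg.neg
    sub := Sub.sub
    sub_eq_add_neg := fun a b => sub_eq_add_neg (G := Module.End ℂ (Fock N)) a b
    zsmul := zsmulRec
    intCast := Int.castDef
    neg_add_cancel := fun a => neg_add_cancel (G := Module.End ℂ (Fock N)) a }

instance opAddCommGroup : AddCommGroup (Op N) := opRing.toAddCommGroup

/-! ### Locally finite sums of operators -/

theorem op_ext {A B : Op N} (h : ∀ S, A (ket S) = B (ket S)) : A = B :=
  Finsupp.lhom_ext' fun S => LinearMap.ext_ring (h S)

theorem single_eq_smul_ket (S : Finset (Mode N)) (c : ℂ) :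
    (Finsupp.single S c : Fock N) = c • ket S := by
  simp [ket]

/-- The family `A` is locally finite and its sum is `X`. -/
def HasLocSum {ι : Type} (A : ι → Op N) (X : Op N) : Prop :=
  ∀ Ψ, (Function.support fun i => A i Ψ).Finite ∧ X Ψ = ∑ᶠ i, A i Ψ

theorem support_finite_of_ket {ι : Type} {A : ι → Op N}
    (h : ∀ S, {i | A i (ket S) ≠ 0}.Finite) (Ψ : Fock N) :
    (Function.support fun i => A i Ψ).Finite := by
  induction Ψ using Finsupp.induction_linear with
  | zero => simp
  | add f g hf hg =>
    refine (hf.union hg).subset ?_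
    simp only [map_add]
    exact Function.support_add _ _
  | single S c =>
    refine (h S).subset fun i hi => ?_
    rw [single_eq_smul_ket, Function.mem_support, map_smul] at hi
    exact fun h0 => hi (by rw [h0, smul_zero])

theorem hasLocSum_locSum {ι : Type} {A : ι → Op N}
    (h : ∀ S, {i | A i (ket S) ≠ 0}.Finite) : HasLocSum A (locSum A) := by
  intro Ψ
  refine ⟨support_finite_of_ket h Ψ, ?_⟩
  induction Ψ using Finsupp.induction_linear with
  | zero => simp
  | add f g hf hg =>
    simp only [map_add]
    rw [finsum_add_distrib (support_finite_of_ket h f) (support_finite_of_ket h g), hf, hg]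
  | single S c =>
    simp only [single_eq_smul_ket, map_smul]
    rw [← smul_finsum]
    congr 1
    rw [locSum, ket, Finsupp.linearCombination_single, one_smul]
    rfl

namespace HasLocSum

variable {ι κ : Type} {A B : ι → Op N} {X Y : Op N}

theorem unique (hX : HasLocSum A X) (hY : HasLocSum A Y) : X = Y :=
  LinearMap.ext fun Ψ => (hX Ψ).2.trans (hY Ψ).2.symm

theorem locSum_eq (hX : HasLocSum A X) : locSum A = X :=
  (hasLocSum_locSum fun S => (hX (ket S)).1).unique hX

theorem add (hX : HasLocSum A X) (hY : HasLocSum B Y) :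
    HasLocSum (fun i => A i + B i) (X + Y) := fun Ψ => by
  refine ⟨((hX Ψ).1.union (hY Ψ).1).subset (Function.support_add _ _), ?_⟩
  simp only [LinearMap.add_apply]
  rw [finsum_add_distrib (hX Ψ).1 (hY Ψ).1, (hX Ψ).2, (hY Ψ).2]

theorem mul_left (Z : Op N) (hX : HasLocSum A X) : HasLocSum (fun i => Z * A i) (Z * X) :=
  fun Ψ => by
  refine ⟨(hX Ψ).1.subset fun i hi h0 => hi (by
    change Z (A i Ψ) = 0
    rw [show A i Ψ = 0 from h0, map_zero]), ?_⟩
  simp only [Module.End.mul_apply]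
  rw [(hX Ψ).2]
  exact (Z : Fock N →+ Fock N).map_finsum (hX Ψ).1

theorem mul_right (Z : Op N) (hX : HasLocSum A X) : HasLocSum (fun i => A i * Z) (X * Z) :=
  fun Ψ => hX (Z Ψ)

theorem smul (c : ℂ) (hX : HasLocSum A X) : HasLocSum (fun i => c • A i) (c • X) := by
  simpa using hX.mul_left (c • (1 : Op N))

theorem neg (hX : HasLocSum A X) : HasLocSum (fun i => -A i) (-X) := by
  simpa using hX.smul (-1)

theorem sub (hX : HasLocSum A X) (hY : HasLocSum B Y) :
    HasLocSum (fun i => A i - B i) (X - Y) := by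
  simpa only [sub_eq_add_neg] using hX.add hY.neg

theorem congr (hX : HasLocSum A X) (h : ∀ i, A i = B i) : HasLocSum B X :=
  (funext h : A = B) ▸ hX

theorem reindex (e : κ ≃ ι) (hX : HasLocSum A X) : HasLocSum (fun k => A (e k)) X := fun Ψ =>
  ⟨((hX Ψ).1.preimage e.injective.injOn), by
    rw [(hX Ψ).2]; exact (finsum_comp_equiv e).symm⟩

theorem finset_sum {α : Type*} (s : Finset α) {A : α → ι → Op N} {X : α → Op N}
    (h : ∀ a ∈ s, HasLocSum (A a) (X a)) :
    HasLocSum (fun i => ∑ a ∈ s, A a i) (∑ a ∈ s, X a) := by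
  classical
  induction s using Finset.induction_on with
  | empty => intro Ψ; simp
  | insert a s ha ih =>
    simp only [Finset.sum_insert ha]
    exact (h a (by simp)).add (ih fun b hb => h b (by simp [hb]))

end HasLocSum

theorem hasLocSum_of_finset {ι : Type} {A : ι → Op N} (s : Finset ι) (h : ∀ i ∉ s, A i = 0) :
    HasLocSum A (∑ i ∈ s, A i) := fun Ψ => by
  have hs : (Function.support fun i => A i Ψ) ⊆ s := fun i hi => by
    by_contra hn
    exact hi (by simp [h i hn])
  exact ⟨s.finite_toSet.subset hs, by
    rw [finsum_eq_sum_of_support_subset _ hs, LinearMap.sum_apply]⟩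

theorem hasLocSum_single {ι : Type} [DecidableEq ι] (i₀ : ι) (A : ι → Op N) :
    HasLocSum (fun i => if i = i₀ then A i else 0) (A i₀) := by
  simpa using hasLocSum_of_finset (A := fun i => if i = i₀ then A i else 0) {i₀}
    (by simp +contextual)

theorem hasLocSum_zero {ι : Type} : HasLocSum (fun _ : ι => (0 : Op N)) 0 := by
  simpa using hasLocSum_of_finset (A := fun _ : ι => (0 : Op N)) ∅ (by simp)

/-- The number of integers between two thresholds, with sign. -/
theorem hasLocSum_threshold (a b : ℤ) (X : Op N) :
    HasLocSum (fun k : ℤ => ((if k < a then 1 else 0) - (if k < b then 1 else 0) : ℂ) • X)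
      (((a : ℂ) - b) • X) := by
  have key : ∀ a b : ℤ, b ≤ a → HasLocSum
      (fun k : ℤ => ((if k < a then 1 else 0) - (if k < b then 1 else 0) : ℂ) • X)
      (((a : ℂ) - b) • X) := fun a b hab => by
    have := hasLocSum_of_finset (N := N) (A := fun k : ℤ =>
      ((if k < a then 1 else 0) - (if k < b then 1 else 0) : ℂ) • X) (Finset.Ico b a)
      fun k hk => by
        rw [Finset.mem_Ico] at hk
        by_cases h1 : k < a
        · have h2 : k < b := by omega
          simp [h1, h2]
        · have h2 : ¬ k < b := by omega
          simp [h1, h2]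
    convert this using 1
    rw [← Finset.sum_smul, Finset.sum_congr rfl (g := fun _ => (1 : ℂ))]
    · congr 1
      rw [Finset.sum_const, Int.card_Ico, nsmul_eq_mul, mul_one, ← Int.cast_natCast (R := ℂ),
        Int.toNat_of_nonneg (by omega), Int.cast_sub]
    · intro k hk
      rw [Finset.mem_Ico] at hk
      have h2 : ¬ k < b := by omega
      simp [hk.2, h2]
  rcases le_total b a with h | h
  · exact key a b h
  · have := (key b a h).neg
    simp only [← neg_smul, neg_sub] at this
    exact this

theorem eventually_apply_eq_zero {ι : Type} {l : Filter ι} {A : ι → Op N}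
    (h : ∀ S, ∀ᶠ i in l, A i (ket S) = 0) (Ψ : Fock N) : ∀ᶠ i in l, A i Ψ = 0 := by
  induction Ψ using Finsupp.induction_linear with
  | zero => simp
  | add f g hf hg => filter_upwards [hf, hg] with i h1 h2; rw [map_add, h1, h2, add_zero]
  | single S c =>
    filter_upwards [h S] with i hi
    rw [single_eq_smul_ket, map_smul, hi, smul_zero]

/-- Meant for products of two fields ordered at a threshold `t`: on either side of `t`, the factor
acting first kills any given state once `m` is far enough out. -/
theorem locallyFinite_of_eventually {X A B : ℤ → Op N} (t : ℤ)
    (h1 : ∀ m < t, ∃ D, X m = D * B m) (h2 : ∀ m, t ≤ m → ∃ D, X m = D * A m)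
    (hA : ∀ Ψ, ∀ᶠ m in Filter.atTop, A m Ψ = 0) (hB : ∀ Ψ, ∀ᶠ m in Filter.atBot, B m Ψ = 0) :
    HasLocSum X (locSum X) := by
  refine hasLocSum_locSum fun S => ?_
  obtain ⟨a, ha⟩ := Filter.eventually_atTop.mp (hA (ket S))
  obtain ⟨b, hb⟩ := Filter.eventually_atBot.mp (hB (ket S))
  refine (Set.finite_Icc (min b t) (max a t)).subset fun m hm => ?_
  by_contra hc
  apply hm
  rw [Set.mem_Icc, not_and_or, min_le_iff, le_max_iff] at hc
  by_cases h : m < t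
  · obtain ⟨D, hD⟩ := h1 m h
    rw [hD, Module.End.mul_apply, hb m (by omega), map_zero]
  · obtain ⟨D, hD⟩ := h2 m (by omega)
    rw [hD, Module.End.mul_apply, ha m (by omega), map_zero]

/-! ### Canonical anticommutation relations -/

theorem create_ket (m : Mode N) (S : Finset (Mode N)) :
    create m (ket S) = if m ∈ S then 0 else fermiSign m S • ket (insert m S) := by
  simp [create, ket]

theorem fermiSign_mul_self (m : Mode N) (S : Finset (Mode N)) :
    fermiSign m S * fermiSign m S = 1 := by
  rw [fermiSign, ← mul_pow]; simp

theorem fermiSign_insert {m m' : Mode N} {S : Finset (Mode N)} (h : m' ∉ S) :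
    fermiSign m (insert m' S) = (if m' < m then -1 else 1) * fermiSign m S := by
  rw [fermiSign, fermiSign, Finset.filter_insert]
  split_ifs with h1
  · rw [Finset.card_insert_of_notMem (by simp [h]), pow_succ']
  · rw [one_mul]

theorem fermiSign_erase {m m' : Mode N} {S : Finset (Mode N)} (h : m' ∈ S) :
    fermiSign m (S.erase m') = (if m' < m then -1 else 1) * fermiSign m S := by
  conv_rhs => rw [← Finset.insert_erase h, fermiSign_insert (Finset.notMem_erase m' S)]
  split_ifs <;> simp

theorem annihilate_annihilate (m m' : Mode N) :
    annihilate m * annihilate m' = -(annihilate m' * annihilate m) := by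
  refine op_ext fun S => ?_
  simp only [Module.End.mul_apply, LinearMap.neg_apply, annihilate_ket]
  rcases eq_or_ne m m' with rfl | hne
  · by_cases h : m ∈ S <;> simp [h, annihilate_ket]
  by_cases h : m ∈ S <;> by_cases h' : m' ∈ S <;>
    simp only [h, h', if_true, if_false, map_smul, map_zero, annihilate_ket, Finset.mem_erase, ne_eq,
      hne, hne.symm, not_false_eq_true, and_self, and_false, fermiSign_erase, smul_zero, neg_zero]
  rw [Finset.erase_right_comm, smul_smul, smul_smul, ← neg_smul]
  congr 1
  -- Exactly one of the two orders of `m`, `m'` holds, so removing the other mode flips exactly one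
  -- of the two signs.
  rcases lt_or_gt_of_ne hne with hl | hl <;> simp [hl, hl.not_gt, mul_comm]

theorem create_create (m m' : Mode N) : create m * create m' = -(create m' * create m) := by
  refine op_ext fun S => ?_
  simp only [Module.End.mul_apply, LinearMap.neg_apply, create_ket]
  rcases eq_or_ne m m' with rfl | hne
  · by_cases h : m ∈ S <;> simp [h, create_ket]
  by_cases h : m ∈ S <;> by_cases h' : m' ∈ S <;>
    simp only [h, h', if_true, if_false, map_smul, map_zero, create_ket, Finset.mem_insert,
      hne, hne.symm, or_self, or_true, not_false_eq_true, fermiSign_insert, smul_zero, neg_zero]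
  rw [Finset.insert_comm, smul_smul, smul_smul, ← neg_smul]
  congr 1
  rcases lt_or_gt_of_ne hne with hl | hl <;> simp [hl, hl.not_gt, mul_comm]

theorem annihilate_create (m m' : Mode N) :
    annihilate m * create m' + create m' * annihilate m = if m = m' then 1 else 0 := by
  refine op_ext fun S => ?_
  simp only [Module.End.mul_apply, LinearMap.add_apply, create_ket, annihilate_ket]
  rcases eq_or_ne m m' with rfl | hne
  · by_cases h : m ∈ S
    · simp only [h, if_true, map_smul, map_zero, create_ket, Finset.notMem_erase, if_false,
        Finset.insert_erase, smul_smul, fermiSign_erase, lt_irrefl, one_mul, zero_add,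
        fermiSign_mul_self, one_smul, Module.End.one_apply]
    · simp only [h, if_true, map_smul, map_zero, annihilate_ket, Finset.mem_insert_self, if_false,
        Finset.erase_insert, smul_smul, fermiSign_insert, lt_irrefl, one_mul, add_zero,
        fermiSign_mul_self, one_smul, Module.End.one_apply, not_false_eq_true]
  by_cases h : m ∈ S <;> by_cases h' : m' ∈ S <;>
    simp only [h, h', if_true, if_false, map_smul, map_zero, create_ket, annihilate_ket,
      Finset.mem_insert, Finset.mem_erase, hne, hne.symm, or_false, or_true, and_true, and_false,
      not_false_eq_true, smul_zero, add_zero, ne_eq, LinearMap.zero_apply]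
  rw [Finset.erase_insert_of_ne hne.symm, smul_smul, smul_smul, ← add_smul, fermiSign_insert h',
    fermiSign_erase h]
  convert zero_smul ℂ _
  rcases lt_or_gt_of_ne hne with hl | hl <;> simp [hl, hl.not_gt, mul_comm]

theorem mode_eq_iff {I J : Fin N} {k l : ℤ} :
    (toLex (I, k) : Mode N) = toLex (J, l) ↔ I = J ∧ k = l := by
  rw [toLex_inj, Prod.mk.injEq]

theorem psi_psi (I J : Fin N) (k l : ℤ) : psi I k * psi J l = -(psi J l * psi I k) := by
  -- An annihilator and a creator among the `psi` have mode numbers of opposite type, so they never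
  -- belong to the same mode and no contraction arises.
  have key : ∀ (I J : Fin N) (k l : ℤ), 0 ≤ k → ¬ 0 ≤ l →
      annihilate (toLex (I, k)) * create (toLex (J, l)) =
        -(create (toLex (J, l)) * annihilate (toLex (I, k))) := fun I J k l hk hl => by
    rw [eq_neg_iff_add_eq_zero, annihilate_create, if_neg]
    rw [mode_eq_iff]; omega
  by_cases hk : 0 ≤ k <;> by_cases hl : 0 ≤ l <;> simp only [psi, hk, hl, if_true, if_false]
  · exact annihilate_annihilate _ _
  · exact key I J k l hk hl
  · rw [key J I l k hl hk, neg_neg]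
  · exact create_create _ _

theorem psiDag_psiDag (I J : Fin N) (k l : ℤ) :
    psiDag I k * psiDag J l = -(psiDag J l * psiDag I k) := by
  have key : ∀ (I J : Fin N) (k l : ℤ), 0 ≤ k → ¬ 0 ≤ l →
      create (toLex (I, k)) * annihilate (toLex (J, l)) =
        -(annihilate (toLex (J, l)) * create (toLex (I, k))) := fun I J k l hk hl => by
    rw [eq_neg_iff_add_eq_zero, add_comm, annihilate_create, if_neg]
    rw [mode_eq_iff]; omega
  by_cases hk : 0 ≤ k <;> by_cases hl : 0 ≤ l <;> simp only [psiDag, hk, hl, if_true, if_false]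
  · exact create_create _ _
  · exact key I J k l hk hl
  · rw [key J I l k hl hk, neg_neg]
  · exact annihilate_annihilate _ _

theorem psi_psiDag (I J : Fin N) (k l : ℤ) :
    psi I k * psiDag J l = (if I = J ∧ k = l then 1 else 0) - psiDag J l * psi I k := by
  rw [eq_sub_iff_add_eq]
  by_cases hk : 0 ≤ k <;> by_cases hl : 0 ≤ l <;> simp only [psi, psiDag, hk, hl, if_true, if_false]
  · rw [annihilate_create]; simp only [mode_eq_iff]
  · rw [annihilate_annihilate, neg_add_cancel, if_neg (by omega)]
  · rw [create_create, neg_add_cancel, if_neg (by omega)]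
  · rw [add_comm, annihilate_create]
    simp only [mode_eq_iff, eq_comm]

/-- Normal ordering only subtracts a c-number, the vacuum expectation value. It drops out of
commutators term by term, and matters again when infinite sums are shifted. -/
theorem normalOrd_eq (I : Fin N) (k l : ℤ) :
    normalOrd I k l = psiDag I k * psi I l - (if k = l ∧ l < 0 then 1 else 0) := by
  by_cases hl : 0 ≤ l
  · simp [normalOrd, hl, hl.not_gt]
  · simp only [normalOrd, hl, if_false, not_le.mp hl, and_true, psi_psiDag, true_and, eq_comm]
    abel

theorem normalOrd_mul_psi (I J : Fin N) (k l p : ℤ) :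
    normalOrd J k l * psi I p - psi I p * normalOrd J k l =
      if I = J ∧ p = k then -psi J l else 0 := by
  have h1 : psi I p * (psiDag J k * psi J l) =
      (if I = J ∧ p = k then psi J l else 0) - psiDag J k * (psi I p * psi J l) := by
    rw [← mul_assoc, psi_psiDag, sub_mul, mul_assoc, ite_mul, one_mul, zero_mul]
  rw [normalOrd_eq, sub_mul, mul_sub, h1, mul_assoc, psi_psi J I]
  split_ifs <;> simp <;> abel

theorem normalOrd_mul_psiDag (I J : Fin N) (k l p : ℤ) :
    normalOrd J k l * psiDag I p - psiDag I p * normalOrd J k l =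
      if I = J ∧ p = l then psiDag J k else 0 := by
  have h1 : psiDag J k * psi J l * psiDag I p =
      (if I = J ∧ p = l then psiDag J k else 0) + psiDag I p * (psiDag J k * psi J l) := by
    rw [mul_assoc, psi_psiDag, mul_sub, ← mul_assoc, psiDag_psiDag J I, mul_ite, mul_one, mul_zero,
      neg_mul, sub_neg_eq_add, mul_assoc]
    simp only [eq_comm]
  rw [normalOrd_eq, sub_mul, mul_sub, h1]
  split_ifs <;> simp

/-! ### Fermion bilinears -/

theorem hasLocSum_bilinear (w : ℤ → ℂ) (I : Fin N) (n : ℤ) :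
    HasLocSum (fun k : ℤ => w k • normalOrd I k (k + n))
      (locSum fun k : ℤ => w k • normalOrd I k (k + n)) :=
  hasLocSum_locSum fun S => (normalOrd_locallyFinite I n S).subset fun k hk h0 =>
    hk (by simp only [LinearMap.smul_apply, h0, smul_zero])

theorem hasLocSum_current (I : Fin N) (n : ℤ) :
    HasLocSum (fun k : ℤ => normalOrd I k (k + n)) (current I n) :=
  hasLocSum_locSum fun S => normalOrd_locallyFinite I n S

theorem bilinear_mul_psi (w : ℤ → ℂ) (I J : Fin N) (n p : ℤ) :
    (locSum fun k : ℤ => w k • normalOrd J k (k + n)) * psi I p -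
      psi I p * (locSum fun k : ℤ => w k • normalOrd J k (k + n)) =
        if I = J then -(w p • psi J (p + n)) else 0 := by
  have h := hasLocSum_bilinear w J n
  refine ((h.mul_right (psi I p)).sub (h.mul_left (psi I p))).unique ?_
  simp only [smul_mul_assoc, mul_smul_comm, ← smul_sub, normalOrd_mul_psi]
  by_cases hIJ : I = J
  · simp only [hIJ, true_and, if_true]
    refine (hasLocSum_single p fun k => -(w k • psi J (k + n))).congr fun k => ?_
    by_cases hk : k = p
    · simp [hk]
    · simp [hk, Ne.symm hk]
  · simpa [hIJ] using hasLocSum_zero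

theorem bilinear_mul_psiDag (w : ℤ → ℂ) (I J : Fin N) (n p : ℤ) :
    (locSum fun k : ℤ => w k • normalOrd J k (k + n)) * psiDag I p -
      psiDag I p * (locSum fun k : ℤ => w k • normalOrd J k (k + n)) =
        if I = J then w (p - n) • psiDag J (p - n) else 0 := by
  have h := hasLocSum_bilinear w J n
  refine ((h.mul_right (psiDag I p)).sub (h.mul_left (psiDag I p))).unique ?_
  simp only [smul_mul_assoc, mul_smul_comm, ← smul_sub, normalOrd_mul_psiDag]
  by_cases hIJ : I = J
  · simp only [hIJ, true_and, if_true]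
    refine (hasLocSum_single (p - n) fun k => w k • psiDag J k).congr fun k => ?_
    by_cases hk : k = p - n
    · simp [hk]
    · simp [hk, show ¬ p = k + n by omega]
  · simpa [hIJ] using hasLocSum_zero

theorem current_mul_psi (I J : Fin N) (n p : ℤ) :
    current J n * psi I p = psi I p * current J n + if I = J then -psi J (p + n) else 0 := by
  have := bilinear_mul_psi 1 I J n p
  simp only [Pi.one_apply, one_smul] at this
  rw [← this, current]; abel

theorem current_mul_psiDag (I J : Fin N) (n p : ℤ) :
    current J n * psiDag I p =
      psiDag I p * current J n + if I = J then psiDag J (p - n) else 0 := by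
  have := bilinear_mul_psiDag 1 I J n p
  simp only [Pi.one_apply, one_smul] at this
  rw [← this, current]; abel

theorem fermionT_mul_psi (I : Fin N) (n p : ℤ) :
    fermionT N n * psi I p =
      psi I p * fermionT N n - ((p : ℂ) + 1 / 2 + (n : ℂ) / 2) • psi I (p + n) := by
  rw [eq_sub_iff_add_eq, ← sub_eq_zero, fermionT, Finset.sum_mul, Finset.mul_sum,
    add_sub_right_comm, ← Finset.sum_sub_distrib]
  simp only [bilinear_mul_psi (fun k => (k : ℂ) + 1 / 2 + (n : ℂ) / 2)]
  simp

theorem fermionT_mul_psiDag (I : Fin N) (n p : ℤ) :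
    fermionT N n * psiDag I p =
      psiDag I p * fermionT N n + ((p : ℂ) + 1 / 2 - (n : ℂ) / 2) • psiDag I (p - n) := by
  rw [← sub_eq_iff_eq_add', fermionT, Finset.sum_mul, Finset.mul_sum, ← Finset.sum_sub_distrib]
  simp only [bilinear_mul_psiDag (fun k => (k : ℂ) + 1 / 2 + (n : ℂ) / 2)]
  simp only [Finset.sum_ite_eq, Finset.mem_univ, if_true]
  congr 1
  push_cast; ring

/-- The Schwinger term. Term by term the commutator is a difference of two relabelled copies of one
bilinear series. Once normal-ordered, the copies cancel; the normal-ordering constants do not, and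
they add up to `m`. -/
theorem current_commutator (I J : Fin N) (m n : ℤ) :
    current I m * current J n - current J n * current I m =
      (if I = J ∧ m + n = 0 then (m : ℂ) else 0) • (1 : Op N) := by
  have h := hasLocSum_current J n
  refine ((h.mul_left (current I m)).sub (h.mul_right (current I m))).unique ?_
  have key : ∀ k : ℤ, current I m * normalOrd J k (k + n) - normalOrd J k (k + n) * current I m =
      if J = I then psiDag J (k - m) * psi J (k + n) - psiDag J k * psi J (k + n + m) else 0 := by
    intro k
    rw [normalOrd_eq, mul_sub, sub_mul, ← mul_assoc, current_mul_psiDag, add_mul, mul_assoc,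
      current_mul_psi]
    by_cases hIJ : J = I
    · subst hIJ
      simp only [if_true]
      split_ifs <;> noncomm_ring
    · simp only [hIJ, if_false]
      split_ifs <;> noncomm_ring
  by_cases hIJ : J = I
  · subst hIJ
    have h1 := (hasLocSum_current J (m + n)).reindex (Equiv.subRight m)
    have h2 := hasLocSum_current J (m + n)
    -- For `m + n = 0` the shifted series carries the constant `[k < m]` and the unshifted one `[k <
    -- 0]`; their difference sums to `m - 0`.
    have h3 := hasLocSum_threshold (N := N) m 0 (if m + n = 0 then 1 else 0)
    have h4 := (h1.sub h2).add h3
    convert h4.congr fun k => ?_ using 1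
    · by_cases hmn : m + n = 0 <;> simp [hmn]
    rw [key, if_pos rfl]
    simp only [Equiv.subRight_apply, normalOrd_eq]
    have e1 : k - m + (m + n) = k + n := by ring
    have e2 : k + (m + n) = k + n + m := by ring
    rw [e1, e2]
    by_cases hmn : m + n = 0
    · have e3 : k - m = k + n := by omega
      have e4 : k + n + m = k := by omega
      rw [e3, e4, if_pos hmn]
      have e5 : (k + n < 0) ↔ k < m := by omega
      simp only [true_and, e5]
      split_ifs <;> simp <;> abel
    · rw [if_neg hmn, if_neg (by omega), if_neg (by omega)]
      simp
  · simp only [key, hIJ, Ne.symm hIJ, if_false, false_and, zero_smul]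
    exact hasLocSum_zero

/-! ### Operators determined by their commutators with the fermions -/

theorem psi_eventually_zero (I : Fin N) (Ψ : Fock N) :
    ∀ᶠ k : ℤ in Filter.atTop, psi I k Ψ = 0 := by
  refine eventually_apply_eq_zero (fun S => ?_) Ψ
  obtain ⟨B, hB⟩ := exists_bound S
  filter_upwards [Filter.eventually_ge_atTop 0, Filter.eventually_gt_atTop B] with k h0 hk
  rw [psi, if_pos h0, annihilate_ket, if_neg]
  exact fun h => absurd (hB I k h) (by rw [abs_of_nonneg h0]; omega)

theorem current_eventually_zero (I : Fin N) (Ψ : Fock N) :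
    ∀ᶠ n : ℤ in Filter.atTop, current I n Ψ = 0 := by
  refine eventually_apply_eq_zero (fun S => ?_) Ψ
  obtain ⟨B, -, hB⟩ := exists_current_ket_eq_zero S
  filter_upwards [Filter.eventually_gt_atTop B] with n hn using hB I n hn

theorem tendsto_sub_atBot (n : ℤ) : Filter.Tendsto (fun m : ℤ => n - m) Filter.atBot Filter.atTop :=
  Filter.tendsto_atTop.mpr fun b => by
    filter_upwards [Filter.eventually_le_atBot (n - b)] with m hm
    omega

theorem create_eq (I : Fin N) (k : ℤ) :
    create (toLex (I, k)) = if 0 ≤ k then psiDag I k else psi I k := by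
  split_ifs with h <;> simp [psi, psiDag, h]

theorem ket_insert {m : Mode N} {S : Finset (Mode N)} (h : m ∉ S) :
    ket (insert m S) = fermiSign m S • create m (ket S) := by
  rw [create_ket, if_neg h, smul_smul, fermiSign_mul_self, one_smul]

/-- An operator that commutes with all fermion modes and annihilates the vacuum vanishes. -/
theorem eq_zero_of_commute {X : Op N} (h1 : ∀ I k, X * psi I k = psi I k * X)
    (h2 : ∀ I k, X * psiDag I k = psiDag I k * X) (h0 : X (vacuum N) = 0) : X = 0 := by
  refine op_ext fun S => ?_
  rw [LinearMap.zero_apply]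
  induction S using Finset.induction_on with
  | empty => exact h0
  | insert m S hm ih =>
    have hc : X * create m = create m * X := by
      have := create_eq (ofLex m).1 (ofLex m).2
      rw [Prod.mk.eta, toLex_ofLex] at this
      rw [this]
      split_ifs
      · exact h2 _ _
      · exact h1 _ _
    rw [ket_insert hm, map_smul, ← Module.End.mul_apply, hc, Module.End.mul_apply, ih, map_zero,
      smul_zero]

/-- Currents are bilinear in the fermions, so the two signs cancel. -/
theorem commute_current_of_anticommute {X : Op N} (h1 : ∀ I k, psi I k * X = -(X * psi I k))
    (h2 : ∀ I k, psiDag I k * X = -(X * psiDag I k)) (I : Fin N) (n : ℤ) :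
    current I n * X = X * current I n := by
  refine ((hasLocSum_current I n).mul_right X).unique
    (((hasLocSum_current I n).mul_left X).congr fun k => ?_)
  rw [normalOrd_eq, sub_mul, mul_sub, mul_assoc _ _ X, h1, mul_neg, ← mul_assoc _ X, h2, neg_mul,
    neg_neg, mul_assoc]
  split_ifs <;> simp

/-! ### The product of a current and a fermion -/

theorem psi_mul_current (I J : Fin N) (n p : ℤ) :
    psi I p * current J n = current J n * psi I p + if I = J then psi J (p + n) else 0 := by
  rw [current_mul_psi]
  split_ifs <;> simp

theorem psiDag_mul_current (I J : Fin N) (n p : ℤ) :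
    psiDag I p * current J n =
      current J n * psiDag I p - if I = J then psiDag J (p - n) else 0 := by
  rw [current_mul_psiDag, add_sub_cancel_right]

/-- The `k`-th mode of the product of `j^I` and `ψ^I`, ordered at the threshold `t`. -/
def currentPsi (I : Fin N) (t k m : ℤ) : Op N :=
  if m < t then current I m * psi I (k - m) else psi I (k - m) * current I m

theorem currentPsi_locSum (I : Fin N) (t k : ℤ) :
    HasLocSum (currentPsi I t k) (locSum (currentPsi I t k)) := by
  refine locallyFinite_of_eventually t (A := current I) (B := fun m => psi I (k - m))
    (fun m hm => ⟨current I m, by simp [currentPsi, hm]⟩)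
    (fun m hm => ⟨psi I (k - m), by simp [currentPsi, not_lt.mpr hm]⟩)
    (current_eventually_zero I) fun Ψ => (tendsto_sub_atBot k).eventually (psi_eventually_zero I Ψ)

/-- For equal flavours the anticommutator is the sum over m of ψ_{l+m} ψ_{k-m}. The reflection m ↦ k
- l - m exchanges the factors, so the sum equals its own negative. -/
theorem currentPsi_psi (I J : Fin N) (t k l : ℤ) :
    locSum (currentPsi I t k) * psi J l + psi J l * locSum (currentPsi I t k) = 0 := by
  have h := currentPsi_locSum I t k
  have h1 : HasLocSum (fun m : ℤ => if J = I then psi I (l + m) * psi I (k - m) else 0)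
      (locSum (currentPsi I t k) * psi J l + psi J l * locSum (currentPsi I t k)) := by
    refine ((h.mul_right (psi J l)).add (h.mul_left (psi J l))).congr fun m => ?_
    unfold currentPsi
    split_ifs with hm hIJ hIJ
    · subst hIJ
      rw [mul_assoc, psi_psi _ _ (k - m), ← mul_assoc (psi J l), psi_mul_current, if_pos rfl]
      noncomm_ring
    · rw [mul_assoc, psi_psi _ _ (k - m), ← mul_assoc (psi J l), psi_mul_current, if_neg hIJ]
      noncomm_ring
    · subst hIJ
      rw [mul_assoc, current_mul_psi, if_pos rfl, ← mul_assoc (psi J l), psi_psi _ _ l,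
        psi_psi _ _ (l + m)]
      noncomm_ring
    · rw [mul_assoc, current_mul_psi, if_neg hIJ, ← mul_assoc (psi J l), psi_psi _ _ l]
      noncomm_ring
  have h2 := ((h1.reindex (Equiv.subLeft (k - l))).neg).congr (B := fun m : ℤ =>
    if J = I then psi I (l + m) * psi I (k - m) else 0) fun m => by
      simp only [Equiv.subLeft_apply]
      split_ifs
      · rw [psi_psi, neg_neg]
        congr 2 <;> ring
      · simp
  have h3 := h1.unique h2
  have h4 : (2 : ℂ) • (locSum (currentPsi I t k) * psi J l +
      psi J l * locSum (currentPsi I t k)) = 0 := by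
    rw [two_smul]; nth_rewrite 2 [h3]; exact add_neg_cancel _
  exact (smul_eq_zero.mp h4).resolve_left two_ne_zero

/-- For equal flavours, contracting ψ with ψ† leaves j_{k-l}, while commuting j past ψ† produces the
same current with a minus sign. Only the constants survive, and they count the modes from `t` to
`k`. -/
theorem currentPsi_psiDag (I J : Fin N) (t k l : ℤ) :
    locSum (currentPsi I t k) * psiDag J l + psiDag J l * locSum (currentPsi I t k) =
      if J = I ∧ k = l then ((k : ℂ) + 1 - t) • 1 else 0 := by
  have h := currentPsi_locSum I t k
  refine ((h.mul_right (psiDag J l)).add (h.mul_left (psiDag J l))).unique ?_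
  by_cases hIJ : J = I
  · subst hIJ
    have hp : ∀ m : ℤ, psi J (k - m) * psiDag J l =
        (if m = k - l then 1 else 0) - psiDag J l * psi J (k - m) := fun m => by
      rw [psi_psiDag]
      congr 1
      exact if_congr (by omega) rfl rfl
    have hp' : ∀ m : ℤ, psi J (k - m) * psiDag J (l - m) =
        (if k = l then 1 else 0) - psiDag J (l - m) * psi J (k - m) := fun m => by
      rw [psi_psiDag]
      congr 1
      exact if_congr (by omega) rfl rfl
    have key : ∀ m : ℤ, currentPsi J t k m * psiDag J l + psiDag J l * currentPsi J t k m =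
        (if m = k - l then current J m else 0) - psiDag J (l - m) * psi J (k - m) +
          (if t ≤ m then if k = l then 1 else 0 else 0) := by
      intro m
      by_cases hm : m < t
      · rw [currentPsi, if_pos hm, mul_assoc, hp, ← mul_assoc (psiDag J l), psiDag_mul_current,
          if_pos rfl, if_neg (not_le.mpr hm)]
        split_ifs <;> noncomm_ring
      · rw [currentPsi, if_neg hm, mul_assoc, current_mul_psiDag, if_pos rfl, mul_add,
          ← mul_assoc, hp, hp', if_pos (not_lt.mp hm)]
        split_ifs <;> noncomm_ring
    have h1 := (hasLocSum_current J (k - l)).reindex (Equiv.subLeft l)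
    have h2 := hasLocSum_single (k - l) (current J)
    -- For `k = l` the contraction contributes `[t ≤ m]` and normal ordering removes `[k < m]`; the
    -- difference is `[m < k + 1] - [m < t]`.
    have h3 := hasLocSum_threshold (N := N) (k + 1) t (if k = l then 1 else 0)
    convert ((h2.sub h1).add h3).congr fun m => ?_ using 1
    · by_cases hkl : k = l <;> simp [hkl]
    · rw [key]
      simp only [Equiv.subLeft_apply, normalOrd_eq]
      have e1 : l - m + (k - l) = k - m := by ring
      rw [e1]
      by_cases hkl : k = l
      · subst hkl
        have e2 : k - m < 0 ↔ ¬ m < k + 1 := by omega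
        have e3 : t ≤ m ↔ ¬ m < t := by omega
        simp only [true_and, if_true, e2, e3]
        split_ifs <;> simp <;> abel
      · rw [if_neg hkl, if_neg (show ¬ (l - m = k - m ∧ k - m < 0) by omega)]
        simp
  · have key : ∀ m : ℤ, currentPsi I t k m * psiDag J l + psiDag J l * currentPsi I t k m = 0 := by
      intro m
      have hp : psi I (k - m) * psiDag J l = -(psiDag J l * psi I (k - m)) := by
        rw [psi_psiDag, if_neg fun hc => hIJ hc.1.symm, zero_sub]
      have hc := current_mul_psiDag J I m l
      rw [if_neg hIJ, add_zero] at hc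
      unfold currentPsi
      split_ifs
      · rw [mul_assoc, hp, mul_neg, ← mul_assoc, hc, mul_assoc, neg_add_cancel]
      · rw [mul_assoc, hc, ← mul_assoc, hp, neg_mul, mul_assoc, neg_add_cancel]
    simpa [key, hIJ] using hasLocSum_zero

theorem currentPsi_charge (I : Fin N) (t k : ℤ) :
    current I 0 * locSum (currentPsi I t k) - locSum (currentPsi I t k) * current I 0 =
      -locSum (currentPsi I t k) := by
  have h := currentPsi_locSum I t k
  refine ((h.mul_left (current I 0)).sub (h.mul_right (current I 0))).unique
    (h.neg.congr fun m => ?_)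
  have hc : current I 0 * current I m = current I m * current I 0 := by
    rw [← sub_eq_zero, current_commutator]; simp +contextual
  have hp : current I 0 * psi I (k - m) = psi I (k - m) * current I 0 - psi I (k - m) := by
    rw [current_mul_psi]; simp [sub_eq_add_neg]
  unfold currentPsi
  split_ifs
  · rw [← mul_assoc, hc, mul_assoc, hp, mul_sub, mul_assoc]; abel
  · rw [← mul_assoc, hp, sub_mul, mul_assoc, hc, mul_assoc]; abel

/-- `:j^I ψ^I:` is proportional to `ψ^I`, with a coefficient linear in the mode number. -/
theorem hasLocSum_currentPsi (I : Fin N) (t k : ℤ) :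
    HasLocSum (currentPsi I t k) (((k : ℂ) + 1 - t) • psi I k) := by
  have h := currentPsi_locSum I t k
  convert h using 1
  set X := locSum (currentPsi I t k)
  -- The defect `Y` anticommutes with all fermion modes and has charge -1 under `current I 0`.
  set Y := X - ((k : ℂ) + 1 - t) • psi I k with hY
  have h1 : ∀ J l, psi J l * Y = -(Y * psi J l) := fun J l => by
    rw [eq_neg_iff_add_eq_zero, hY, mul_sub, sub_mul, smul_mul_assoc, psi_psi I J k l,
      mul_smul_comm, smul_neg, sub_neg_eq_add, ← currentPsi_psi I J t k l]
    abel
  have h2 : ∀ J l, psiDag J l * Y = -(Y * psiDag J l) := fun J l => by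
    rw [eq_neg_iff_add_eq_zero, hY, mul_sub, sub_mul, smul_mul_assoc, psi_psiDag I J k l,
      mul_smul_comm, smul_sub]
    have := eq_sub_of_add_eq (currentPsi_psiDag I J t k l)
    rw [this]
    by_cases hIJ : I = J ∧ k = l
    · rw [if_pos hIJ, if_pos ⟨hIJ.1.symm, hIJ.2⟩]; abel
    · rw [if_neg hIJ, if_neg fun h => hIJ ⟨h.1.symm, h.2⟩, smul_zero]; abel
  have h3 : current I 0 * Y - Y * current I 0 = -Y := by
    have hp := current_mul_psi I I 0 k
    rw [hY, mul_sub, sub_mul, mul_smul_comm, hp, smul_mul_assoc, neg_sub, smul_add, if_pos rfl,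
      add_zero, smul_neg, sub_eq_add_neg _ X, ← currentPsi_charge I t k, add_comm (_ • psi I k)]
    abel
  -- Anticommuting with every fermion makes `Y` commute with the charge; a commuting operator of
  -- charge -1 vanishes.
  rw [commute_current_of_anticommute h1 h2, sub_self, eq_comm, neg_eq_zero] at h3
  exact (sub_eq_zero.mp h3).symm

/-! ### The inner product and adjoints -/

theorem fockInner_eq_sum {Φ Ψ : Fock N} {s : Finset (Finset (Mode N))} (h : Φ.support ⊆ s) :
    fockInner Φ Ψ = ∑ S ∈ s, conj (Φ S) * Ψ S :=
  Finsupp.sum_of_support_subset _ h _ (by simp)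

theorem fockInner_conj (Φ Ψ : Fock N) : conj (fockInner Φ Ψ) = fockInner Ψ Φ := by
  classical
  rw [fockInner_eq_sum (Finset.subset_union_left (s₂ := Ψ.support)),
    fockInner_eq_sum (Finset.subset_union_right (s₁ := Φ.support)), map_sum]
  exact Finset.sum_congr rfl fun S _ => by simp [mul_comm]

theorem fockInner_ket_left (S : Finset (Mode N)) (Ψ : Fock N) : fockInner (ket S) Ψ = Ψ S := by
  simp [fockInner, ket]

theorem fockInner_add_right (Φ Ψ₁ Ψ₂ : Fock N) :
    fockInner Φ (Ψ₁ + Ψ₂) = fockInner Φ Ψ₁ + fockInner Φ Ψ₂ := by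
  simp [fockInner, mul_add, Finsupp.sum_add]

theorem fockInner_smul_right (c : ℂ) (Φ Ψ : Fock N) :
    fockInner Φ (c • Ψ) = c * fockInner Φ Ψ := by
  simp only [fockInner, Finsupp.mul_sum, Finsupp.smul_apply, smul_eq_mul, mul_left_comm]

/-- The inner product with a fixed state, as a linear form in the second argument. -/
def fockInnerₗ (Φ : Fock N) : Fock N →ₗ[ℂ] ℂ where
  toFun := fockInner Φ
  map_add' := fockInner_add_right Φ
  map_smul' c := fockInner_smul_right c Φ

theorem fockInner_zero_right (Φ : Fock N) : fockInner Φ 0 = 0 := (fockInnerₗ Φ).map_zero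

theorem fockInner_sum_right {ι : Type*} (s : Finset ι) (Φ : Fock N) (Ψ : ι → Fock N) :
    fockInner Φ (∑ i ∈ s, Ψ i) = ∑ i ∈ s, fockInner Φ (Ψ i) :=
  map_sum (fockInnerₗ Φ) _ _

theorem fockInner_finsum_right {ι : Type*} (Φ : Fock N) {Ψ : ι → Fock N}
    (h : (Function.support Ψ).Finite) : fockInner Φ (∑ᶠ i, Ψ i) = ∑ᶠ i, fockInner Φ (Ψ i) :=
  (fockInnerₗ Φ : Fock N →+ ℂ).map_finsum h

theorem fockInner_add_left (Φ₁ Φ₂ Ψ : Fock N) :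
    fockInner (Φ₁ + Φ₂) Ψ = fockInner Φ₁ Ψ + fockInner Φ₂ Ψ := by
  rw [← fockInner_conj, fockInner_add_right, map_add, fockInner_conj, fockInner_conj]

theorem fockInner_smul_left (c : ℂ) (Φ Ψ : Fock N) :
    fockInner (c • Φ) Ψ = conj c * fockInner Φ Ψ := by
  rw [← fockInner_conj, fockInner_smul_right, map_mul, fockInner_conj]

theorem fockInner_zero_left (Ψ : Fock N) : fockInner 0 Ψ = 0 := by
  simp [fockInner]

theorem fockInner_sum_left {ι : Type*} (s : Finset ι) (Φ : ι → Fock N) (Ψ : Fock N) :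
    fockInner (∑ i ∈ s, Φ i) Ψ = ∑ i ∈ s, fockInner (Φ i) Ψ := by
  rw [← fockInner_conj, fockInner_sum_right, map_sum]
  simp only [fockInner_conj]

theorem fockInner_finsum_left {ι : Type*} (Ψ : Fock N) {Φ : ι → Fock N}
    (h : (Function.support Φ).Finite) : fockInner (∑ᶠ i, Φ i) Ψ = ∑ᶠ i, fockInner (Φ i) Ψ := by
  rw [finsum_eq_sum_of_support_subset Φ (s := h.toFinset) (by simp), fockInner_sum_left,
    finsum_eq_sum_of_support_subset]
  intro i hi
  simp only [Set.Finite.coe_toFinset, Function.mem_support]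
  exact fun h0 => hi (by simp [h0, fockInner_zero_left])

theorem fockInner_self (Ψ : Fock N) :
    fockInner Ψ Ψ = ((∑ S ∈ Ψ.support, Complex.normSq (Ψ S) : ℝ) : ℂ) := by
  rw [fockInner_eq_sum subset_rfl, Complex.ofReal_sum]
  exact Finset.sum_congr rfl fun S _ => by rw [mul_comm, Complex.mul_conj]

theorem fockInner_self_nonneg (Ψ : Fock N) : 0 ≤ (fockInner Ψ Ψ).re := by
  rw [fockInner_self, Complex.ofReal_re]
  exact Finset.sum_nonneg fun S _ => Complex.normSq_nonneg _

theorem eq_zero_of_fockInner_self_le {Ψ : Fock N} (h : (fockInner Ψ Ψ).re ≤ 0) : Ψ = 0 := by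
  rw [fockInner_self, Complex.ofReal_re] at h
  have h0 := (Finset.sum_eq_zero_iff_of_nonneg fun S _ => Complex.normSq_nonneg (Ψ S)).mp
    (h.antisymm (Finset.sum_nonneg fun S _ => Complex.normSq_nonneg _))
  ext S
  by_contra hS
  exact hS (Complex.normSq_eq_zero.mp (h0 S (Finsupp.mem_support_iff.mpr hS)))

/-- `B` is the formal adjoint of `A`. -/
def IsAdjoint (A B : Op N) : Prop := ∀ Φ Ψ, fockInner Φ (A Ψ) = fockInner (B Φ) Ψ

theorem isAdjoint_of_ket {A B : Op N}
    (h : ∀ T S, fockInner (ket T) (A (ket S)) = fockInner (B (ket T)) (ket S)) :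
    IsAdjoint A B := by
  intro Φ Ψ
  induction Φ using Finsupp.induction_linear with
  | zero => simp [fockInner_zero_left]
  | add f g hf hg => rw [map_add, fockInner_add_left, fockInner_add_left, hf, hg]
  | single T c =>
    rw [single_eq_smul_ket, map_smul, fockInner_smul_left, fockInner_smul_left]
    congr 1
    induction Ψ using Finsupp.induction_linear with
    | zero => simp [fockInner_zero_right]
    | add f g hf hg => rw [map_add, fockInner_add_right, fockInner_add_right, hf, hg]
    | single S d =>
      rw [single_eq_smul_ket, map_smul, fockInner_smul_right, fockInner_smul_right, h]

namespace IsAdjoint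

variable {A B A' B' : Op N}

theorem symm (h : IsAdjoint A B) : IsAdjoint B A := fun Φ Ψ => by
  rw [← fockInner_conj, ← h, fockInner_conj]

theorem one : IsAdjoint (1 : Op N) 1 := fun _ _ => rfl

theorem zero : IsAdjoint (0 : Op N) 0 := fun _ _ => by
  simp [fockInner_zero_left, fockInner_zero_right]

theorem mul (h : IsAdjoint A B) (h' : IsAdjoint A' B') : IsAdjoint (A * A') (B' * B) :=
  fun _ _ => (h _ _).trans (h' _ _)

theorem add (h : IsAdjoint A B) (h' : IsAdjoint A' B') : IsAdjoint (A + A') (B + B') :=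
  fun Φ Ψ => by
  rw [LinearMap.add_apply, fockInner_add_right, h, h', ← fockInner_add_left, LinearMap.add_apply]

theorem smul (c : ℂ) (h : IsAdjoint A B) : IsAdjoint (c • A) (conj c • B) := fun Φ Ψ => by
  rw [LinearMap.smul_apply, fockInner_smul_right, h, LinearMap.smul_apply, fockInner_smul_left,
    Complex.conj_conj]

theorem smul_real {c : ℂ} (hc : conj c = c) (h : IsAdjoint A B) : IsAdjoint (c • A) (c • B) := by
  have := h.smul c
  rwa [hc] at this

theorem sub (h : IsAdjoint A B) (h' : IsAdjoint A' B') : IsAdjoint (A - A') (B - B') := by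
  have := h.add (h'.smul_real (c := -1) (by simp))
  simpa only [neg_smul, one_smul, ← sub_eq_add_neg] using this

theorem sum {ι : Type*} (s : Finset ι) {A B : ι → Op N} (h : ∀ i ∈ s, IsAdjoint (A i) (B i)) :
    IsAdjoint (∑ i ∈ s, A i) (∑ i ∈ s, B i) := fun Φ Ψ => by
  rw [LinearMap.sum_apply, LinearMap.sum_apply, fockInner_sum_right, fockInner_sum_left]
  exact Finset.sum_congr rfl fun i hi => h i hi Φ Ψ

theorem hasLocSum {ι : Type} {A B : ι → Op N} {X Y : Op N} (hX : HasLocSum A X)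
    (hY : HasLocSum B Y) (h : ∀ i, IsAdjoint (A i) (B i)) : IsAdjoint X Y := fun Φ Ψ => by
  rw [(hX Ψ).2, (hY Φ).2, fockInner_finsum_right Φ (hX Ψ).1, fockInner_finsum_left Ψ (hY Φ).1]
  exact finsum_congr fun i => h i Φ Ψ

theorem ite {p : Prop} [Decidable p] (h : IsAdjoint A B) (h' : IsAdjoint A' B') :
    IsAdjoint (if p then A else A') (if p then B else B') := by
  split_ifs
  exacts [h, h']

theorem unique (h : IsAdjoint A B) (h' : IsAdjoint A B') : B = B' := by
  refine LinearMap.ext fun Φ => ?_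
  ext S
  rw [← fockInner_ket_left, ← fockInner_ket_left, h.symm, h'.symm]

end IsAdjoint

theorem isAdjoint_create (m : Mode N) : IsAdjoint (create m) (annihilate m) := by
  refine isAdjoint_of_ket fun T S => ?_
  rw [← fockInner_conj (ket S), fockInner_ket_left, fockInner_ket_left, create_ket,
    annihilate_ket]
  have key : (m ∉ S ∧ insert m S = T) ↔ (m ∈ T ∧ T.erase m = S) := by
    constructor
    · rintro ⟨h, rfl⟩; exact ⟨Finset.mem_insert_self m S, Finset.erase_insert h⟩
    · rintro ⟨h, rfl⟩; exact ⟨Finset.notMem_erase m T, Finset.insert_erase h⟩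
  by_cases h : m ∉ S ∧ insert m S = T
  · obtain ⟨h1, h2⟩ := key.mp h
    rw [if_neg h.1, if_pos h1, h.2, h2, ← h2, fermiSign_erase h1]
    simp [ket, fermiSign]
  · have h' := mt key.mpr h
    rw [not_and] at h h'
    split_ifs with h1 h2 h2
    · simp [ket, h' h2]
    · simp
    · simp [ket, h h1, h' h2]
    · simp [ket, h h1]

theorem isAdjoint_psi (I : Fin N) (k : ℤ) : IsAdjoint (psi I k) (psiDag I k) :=
  IsAdjoint.ite (isAdjoint_create _).symm (isAdjoint_create _)

theorem isAdjoint_normalOrd (I : Fin N) (k l : ℤ) :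
    IsAdjoint (normalOrd I k l) (normalOrd I l k) := by
  rw [normalOrd_eq, normalOrd_eq,
    show (if l = k ∧ k < 0 then (1 : Op N) else 0) = if k = l ∧ l < 0 then 1 else 0 from
      if_congr (by omega) rfl rfl]
  exact ((isAdjoint_psi I k).symm.mul (isAdjoint_psi I l)).sub (IsAdjoint.one.ite IsAdjoint.zero)

theorem isAdjoint_current (I : Fin N) (n : ℤ) : IsAdjoint (current I n) (current I (-n)) :=
  IsAdjoint.hasLocSum (hasLocSum_current I n)
    (((hasLocSum_current I (-n)).reindex (Equiv.addRight n)).congr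
      (B := fun k => normalOrd I (k + n) k) fun k => by simp)
    fun _ => isAdjoint_normalOrd _ _ _

theorem isAdjoint_fermionT (n : ℤ) : IsAdjoint (fermionT N n) (fermionT N (-n)) :=
  IsAdjoint.sum _ fun I _ => IsAdjoint.hasLocSum
    (hasLocSum_bilinear (fun k => (k : ℂ) + 1 / 2 + (n : ℂ) / 2) I n)
    (((hasLocSum_bilinear (fun k => (k : ℂ) + 1 / 2 + ((-n : ℤ) : ℂ) / 2) I (-n)).reindex
      (Equiv.addRight n)).congr
      (B := fun k : ℤ => ((k : ℂ) + 1 / 2 + (n : ℂ) / 2) • normalOrd I (k + n) k) fun k => by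
        simp only [Equiv.coe_addRight, add_neg_cancel_right]
        congr 1
        push_cast; ring)
    fun k => (isAdjoint_normalOrd _ _ _).smul_real (by simp [map_ofNat])

/-! ### The vacuum -/

theorem normalOrd_vacuum (I : Fin N) {k l : ℤ} (h : 0 ≤ l ∨ k < 0) :
    normalOrd I k l (vacuum N) = 0 := by
  by_contra hk
  -- No mode is occupied, so any bound holds vacuously; the value -1 rules out `0 ≤ l` and, for `l <
  -- 0`, forces `0 ≤ k`.
  rcases normalOrd_ket_bounds (B := -1) (by simp) hk with h | h <;> omega

theorem bilinear_vacuum (w : ℤ → ℂ) (I : Fin N) {n : ℤ} (hn : 0 ≤ n) :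
    (locSum fun k : ℤ => w k • normalOrd I k (k + n)) (vacuum N) = 0 := by
  rw [(hasLocSum_bilinear w I n _).2]
  refine finsum_eq_zero_of_forall_eq_zero fun k => ?_
  rw [LinearMap.smul_apply, normalOrd_vacuum I (by omega), smul_zero]

theorem current_vacuum (I : Fin N) {n : ℤ} (hn : 0 ≤ n) : current I n (vacuum N) = 0 := by
  have := bilinear_vacuum 1 I hn
  simp only [Pi.one_apply, one_smul] at this
  exact this

theorem fermionT_vacuum {n : ℤ} (hn : 0 ≤ n) : fermionT N n (vacuum N) = 0 := by
  rw [fermionT, LinearMap.sum_apply]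
  exact Finset.sum_eq_zero fun I _ => bilinear_vacuum _ I hn

/-! ### The Sugawara construction -/

/-- The normal-ordered product `:j^I_m j^J_l:` (the larger mode number to the right). -/
def numberOrd (I J : Fin N) (m l : ℤ) : Op N :=
  if m ≤ l then current I m * current J l else current J l * current I m

theorem hasLocSum_numberOrd (I J : Fin N) (n : ℤ) :
    HasLocSum (fun m : ℤ => numberOrd I J m (n - m))
      (locSum fun m : ℤ => numberOrd I J m (n - m)) := by
  refine hasLocSum_locSum fun S => ?_
  obtain ⟨B, hB0, hB⟩ := exists_current_ket_eq_zero S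
  refine (Set.finite_Icc (-B - |n|) (B + |n|)).subset fun m hm => ?_
  have h2 := abs_le.mp (le_refl |n|)
  by_contra hc
  apply hm
  rw [Set.mem_Icc, not_and_or] at hc
  by_cases h : m ≤ n - m
  · rw [numberOrd, if_pos h, Module.End.mul_apply, hB J (n - m) (by omega), map_zero]
  · rw [numberOrd, if_neg h, Module.End.mul_apply, hB I m (by omega), map_zero]

/-- The modes of the energy-momentum tensor `(1/2) ∑_{I,J} P_{IJ} :j^I j^J:`. -/
def quadraticT (P : Matrix (Fin N) (Fin N) ℝ) (n : ℤ) : Op N :=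
  (1 / 2 : ℂ) • ∑ I, ∑ J, (P I J : ℂ) • locSum fun m : ℤ => numberOrd I J m (n - m)

theorem isAdjoint_locSum_numberOrd (I J : Fin N) (n : ℤ) :
    IsAdjoint (locSum fun m : ℤ => numberOrd I J m (n - m))
      (locSum fun m : ℤ => numberOrd J I m (-n - m)) := by
  refine IsAdjoint.hasLocSum (hasLocSum_numberOrd I J n)
    ((hasLocSum_numberOrd J I (-n)).reindex (Equiv.subRight n)) fun m => ?_
  have e1 : m - n ≤ -n - (m - n) ↔ m ≤ n - m := by omega
  have e2 : -n - (m - n) = -m := by ring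
  have e3 : m - n = -(n - m) := by ring
  simp only [numberOrd, Equiv.subRight_apply, e1]
  rw [e2, e3]
  exact ((isAdjoint_current I m).mul (isAdjoint_current J (n - m))).ite
    ((isAdjoint_current J (n - m)).mul (isAdjoint_current I m))

theorem isAdjoint_quadraticT {P : Matrix (Fin N) (Fin N) ℝ} (hP : Pᵀ = P) (n : ℤ) :
    IsAdjoint (quadraticT P n) (quadraticT P (-n)) := by
  have h : quadraticT P (-n) = (1 / 2 : ℂ) • ∑ I, ∑ J, (P I J : ℂ) •
      locSum fun m : ℤ => numberOrd J I m (-n - m) := by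
    rw [quadraticT, Finset.sum_comm]
    have hs : ∀ I J, P I J = P J I := fun I J => congrFun (congrFun hP J) I
    simp only [hs]
  rw [h]
  exact (IsAdjoint.sum _ fun I _ => IsAdjoint.sum _ fun J _ =>
    (isAdjoint_locSum_numberOrd I J n).smul_real (by simp)).smul_real (by simp [map_ofNat])

theorem locSum_numberOrd_vacuum (I J : Fin N) {n : ℤ} (hn : 0 ≤ n) :
    (locSum fun m : ℤ => numberOrd I J m (n - m)) (vacuum N) = 0 := by
  rw [(hasLocSum_numberOrd I J n _).2]
  refine finsum_eq_zero_of_forall_eq_zero fun m => ?_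
  simp only [numberOrd]
  split_ifs
  · rw [Module.End.mul_apply, current_vacuum J (by omega), map_zero]
  · rw [Module.End.mul_apply, current_vacuum I (by omega), map_zero]

theorem quadraticT_vacuum (P : Matrix (Fin N) (Fin N) ℝ) {n : ℤ} (hn : 0 ≤ n) :
    quadraticT P n (vacuum N) = 0 := by
  simp [quadraticT, locSum_numberOrd_vacuum _ _ hn]

theorem current_mul_comm {I J : Fin N} {m n : ℤ} (h : m + n ≠ 0 ∨ m = 0) :
    current I m * current J n = current J n * current I m := by
  rw [← sub_eq_zero, current_commutator]
  rcases h with h | h <;> simp [h]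

theorem current_mul_current_mul_psi (I J : Fin N) (m n k : ℤ) :
    current I m * current I n * psi J k - psi J k * (current I m * current I n) =
      if J = I then -(current I m * psi I (k + n)) - psi I (k + m) * current I n else 0 := by
  rw [mul_assoc, current_mul_psi J I n, mul_add, ← mul_assoc (current I m) (psi J k),
    current_mul_psi J I m, add_mul]
  split_ifs <;> noncomm_ring

/-- Commuting ψ through j j leaves two products of j with ψ, ordered at thresholds 0 and n + 1. By
`hasLocSum_currentPsi` they contribute the coefficients k + n + 1 and k. -/
theorem locSum_numberOrd_mul_psi (I J : Fin N) (n k : ℤ) :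
    (locSum fun m : ℤ => numberOrd I I m (n - m)) * psi J k -
      psi J k * (locSum fun m : ℤ => numberOrd I I m (n - m)) =
        if J = I then -((2 * (k : ℂ) + 1 + n) • psi I (k + n)) else 0 := by
  have h := hasLocSum_numberOrd I I n
  refine ((h.mul_right (psi J k)).sub (h.mul_left (psi J k))).unique ?_
  -- Moving the ordering threshold to 0 is free: the two factors commute for `n ≠ 0`, and for `n =
  -- 0` the orderings differ only at `m = 0`.
  have hord : ∀ m, numberOrd I I m (n - m) = if m < 0 then current I m * current I (n - m)
      else current I (n - m) * current I m := fun m => by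
    unfold numberOrd
    split_ifs
    · rfl
    · exact current_mul_comm (by omega)
    · exact current_mul_comm (by omega)
    · rfl
  by_cases hJ : J = I
  · subst hJ
    have h1 := hasLocSum_currentPsi J 0 (k + n)
    have h2 := (hasLocSum_currentPsi J (n + 1) (k + n)).reindex (Equiv.subLeft n)
    convert ((h1.add h2).neg).congr fun m => ?_ using 1
    · rw [if_pos rfl, ← add_smul]
      congr 2
      push_cast; ring
    · have e1 : n - m < n + 1 ↔ ¬ m < 0 := by omega
      have e2 : k + n - (n - m) = k + m := by ring
      have e3 : k + n - m = k + (n - m) := by ring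
      rw [hord]
      simp only [currentPsi, Equiv.subLeft_apply, e1, e2, e3]
      split_ifs
      · rw [current_mul_current_mul_psi, if_pos rfl]
        noncomm_ring
      · rw [current_mul_current_mul_psi, if_pos rfl]
        noncomm_ring
  · have hz : ∀ m, numberOrd I I m (n - m) * psi J k - psi J k * numberOrd I I m (n - m) = 0 := by
      intro m
      rw [hord]
      split_ifs
      · rw [current_mul_current_mul_psi, if_neg hJ]
      · rw [current_mul_current_mul_psi, if_neg hJ]
    simpa [hz, hJ] using hasLocSum_zero

theorem quadraticT_one (n : ℤ) : quadraticT (1 : Matrix (Fin N) (Fin N) ℝ) n =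
    (1 / 2 : ℂ) • ∑ I, locSum fun m : ℤ => numberOrd I I m (n - m) := by
  rw [quadraticT]
  congr 1
  refine Finset.sum_congr rfl fun I _ => ?_
  simp [Matrix.one_apply]

theorem quadraticT_one_mul_psi (I : Fin N) (n k : ℤ) :
    quadraticT 1 n * psi I k =
      psi I k * quadraticT 1 n - ((k : ℂ) + 1 / 2 + (n : ℂ) / 2) • psi I (k + n) := by
  rw [eq_sub_iff_add_eq, ← sub_eq_zero, add_sub_right_comm, quadraticT_one, smul_mul_assoc,
    mul_smul_comm, ← smul_sub, Finset.sum_mul, Finset.mul_sum, ← Finset.sum_sub_distrib]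
  simp only [locSum_numberOrd_mul_psi, Finset.sum_ite_eq, Finset.mem_univ, if_true]
  rw [smul_neg, smul_smul, neg_add_eq_zero]
  congr 1
  ring

/-- Bosonization of the energy-momentum tensor: the Sugawara tensor of the number currents is the
canonical energy-momentum tensor of the fermions. -/
theorem quadraticT_one_eq (n : ℤ) : quadraticT 1 n = fermionT N n := by
  have key : ∀ n : ℤ, 0 ≤ n → quadraticT 1 n = fermionT N n := fun n hn => by
    -- Needed for both `n` and `-n`: the adjoint of the relation for `-n` gives commutation of mode
    -- `n` with ψ†.
    have hc : ∀ (n : ℤ) I k, (quadraticT 1 n - fermionT N n) * psi I k =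
        psi I k * (quadraticT 1 n - fermionT N n) := fun n I k => by
      rw [sub_mul, quadraticT_one_mul_psi, fermionT_mul_psi, mul_sub]
      abel
    have ha : IsAdjoint (quadraticT 1 (-n) - fermionT N (-n)) (quadraticT 1 n - fermionT N n) := by
      have := (isAdjoint_quadraticT (N := N) Matrix.transpose_one (-n)).sub
        (isAdjoint_fermionT (-n))
      rwa [neg_neg] at this
    rw [← sub_eq_zero]
    refine eq_zero_of_commute (hc n) (fun I k => ?_) ?_
    · refine ((isAdjoint_psi I k).mul ha).unique ?_
      rw [← hc]
      exact ha.mul (isAdjoint_psi I k)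
    · rw [LinearMap.sub_apply, quadraticT_vacuum 1 hn, fermionT_vacuum hn, sub_zero]
  rcases le_total 0 n with hn | hn
  · exact key n hn
  · have h1 := isAdjoint_quadraticT (N := N) Matrix.transpose_one (-n)
    rw [neg_neg, key (-n) (by omega)] at h1
    have h2 := isAdjoint_fermionT (N := N) (-n)
    rw [neg_neg] at h2
    exact h1.unique h2

/-! ### Level matrices -/

theorem eigenvectorUnitary_mul_transpose {n : ℕ} {A : Matrix (Fin n) (Fin n) ℝ}
    (hA : A.IsHermitian) :
    (hA.eigenvectorUnitary : Matrix (Fin n) (Fin n) ℝ) *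
      (hA.eigenvectorUnitary : Matrix (Fin n) (Fin n) ℝ)ᵀ = 1 := by
  have := Unitary.mul_star_self_of_mem hA.eigenvectorUnitary.2
  rwa [Matrix.star_eq_conjTranspose, Matrix.conjTranspose_eq_transpose_of_trivial] at this

theorem eigenvectorUnitary_transpose_mul {n : ℕ} {A : Matrix (Fin n) (Fin n) ℝ}
    (hA : A.IsHermitian) :
    (hA.eigenvectorUnitary : Matrix (Fin n) (Fin n) ℝ)ᵀ *
      (hA.eigenvectorUnitary : Matrix (Fin n) (Fin n) ℝ) = 1 :=
  mul_eq_one_comm.mp (eigenvectorUnitary_mul_transpose hA)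

theorem eq_eigenvectorUnitary_mul {n : ℕ} {A : Matrix (Fin n) (Fin n) ℝ} (hA : A.IsHermitian) :
    A = (hA.eigenvectorUnitary : Matrix (Fin n) (Fin n) ℝ) * Matrix.diagonal hA.eigenvalues *
      (hA.eigenvectorUnitary : Matrix (Fin n) (Fin n) ℝ)ᵀ := by
  conv_lhs => rw [hA.spectral_theorem]
  rw [Unitary.conjStarAlgAut_apply, Matrix.star_eq_conjTranspose,
    Matrix.conjTranspose_eq_transpose_of_trivial]
  rfl

theorem conj_diagonal_mul {n : ℕ} {U : Matrix (Fin n) (Fin n) ℝ} (hU : Uᵀ * U = 1)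
    (d e : Fin n → ℝ) : U * Matrix.diagonal d * Uᵀ * (U * Matrix.diagonal e * Uᵀ) =
      U * Matrix.diagonal (fun i => d i * e i) * Uᵀ := by
  have : U * Matrix.diagonal d * Uᵀ * (U * Matrix.diagonal e * Uᵀ) =
      U * (Matrix.diagonal d * (Uᵀ * U) * Matrix.diagonal e) * Uᵀ := by
    simp only [Matrix.mul_assoc]
  rw [this, hU, Matrix.mul_one, Matrix.diagonal_mul_diagonal]

/-- With `0⁻¹ = 0` the diagonal entries are 0 or 1, so this is the orthogonal projection off the
kernel of K. -/
theorem levelInv_mul_level (Q : Matrix (Fin N) (Fin C) ℤ) :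
    levelInv Q * level Q = ((level_isHermitian Q).eigenvectorUnitary : Matrix (Fin C) (Fin C) ℝ) *
      Matrix.diagonal (fun i => ((level_isHermitian Q).eigenvalues i)⁻¹ *
        (level_isHermitian Q).eigenvalues i) *
      ((level_isHermitian Q).eigenvectorUnitary : Matrix (Fin C) (Fin C) ℝ)ᵀ := by
  conv_lhs => rw [eq_eigenvectorUnitary_mul (level_isHermitian Q), levelInv]
  exact conj_diagonal_mul (eigenvectorUnitary_transpose_mul _) _ _

theorem levelInv_transpose (Q : Matrix (Fin N) (Fin C) ℤ) : (levelInv Q)ᵀ = levelInv Q := by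
  simp [levelInv, Matrix.mul_assoc]

theorem rank_level (Q : Matrix (Fin N) (Fin C) ℤ) : (level Q).rank = (realCharge Q).rank :=
  Matrix.rank_transpose_mul_self _

theorem trace_levelInv_mul_level (Q : Matrix (Fin N) (Fin C) ℤ) :
    (levelInv Q * level Q * (levelInv Q * level Q)).trace = ((realCharge Q).rank : ℝ) := by
  rw [← rank_level, (level_isHermitian Q).rank_eq_card_non_zero_eigs, levelInv_mul_level,
    conj_diagonal_mul (eigenvectorUnitary_transpose_mul _), Matrix.trace_mul_comm,
    ← Matrix.mul_assoc, eigenvectorUnitary_transpose_mul, Matrix.one_mul, Matrix.trace_diagonal,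
    Fintype.card_subtype, Finset.card_filter, Nat.cast_sum]
  refine Finset.sum_congr rfl fun i _ => ?_
  split_ifs with h
  · simp [h]
  · simp [not_not.mp h]

theorem isUnit_of_rank_eq {A : Matrix (Fin N) (Fin N) ℝ} (h : A.rank = N) : IsUnit A := by
  rw [← Matrix.mulVec_surjective_iff_isUnit]
  have : LinearMap.range A.mulVecLin = ⊤ :=
    Submodule.eq_top_of_finrank_eq (by rw [Module.finrank_fin_fun]; exact h)
  exact LinearMap.range_eq_top.mp this

theorem realCharge_mul_levelInv_mul {Q : Matrix (Fin N) (Fin N) ℤ} (h : (realCharge Q).rank = N) :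
    realCharge Q * levelInv Q * (realCharge Q)ᵀ = 1 := by
  have hK : IsUnit (level Q) := isUnit_of_rank_eq ((rank_level Q).trans h)
  have hne : ∀ i, (level_isHermitian Q).eigenvalues i ≠ 0 := by
    intro i hi
    have hdet := (level_isHermitian Q).det_eq_prod_eigenvalues
    rw [Finset.prod_eq_zero (Finset.mem_univ i) (by simp [hi])] at hdet
    rw [Matrix.isUnit_iff_isUnit_det, hdet] at hK
    exact not_isUnit_zero hK
  have h1 : levelInv Q * level Q = 1 := by
    rw [levelInv_mul_level]
    simp only [inv_mul_cancel₀ (hne _)]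
    rw [Matrix.diagonal_one, Matrix.mul_one, eigenvectorUnitary_mul_transpose]
  -- For square matrices the left inverse K⁻¹Qᵗ of Q is also a right inverse.
  rw [level, ← Matrix.mul_assoc, mul_eq_one_comm, ← Matrix.mul_assoc] at h1
  exact h1

/-! ### The Sugawara tensor of the gauge currents -/

theorem currentOrd_eq (Q : Matrix (Fin N) (Fin C) ℤ) (a b : Fin C) (m l : ℤ) :
    currentOrd Q a b m l = ∑ I, ∑ J, ((Q I a : ℂ) * (Q J b : ℂ)) • numberOrd I J m l := by
  unfold currentOrd numberOrd gaugeCurrent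
  split_ifs
  · rw [Finset.sum_mul_sum]
    simp only [smul_mul_smul_comm]
  · rw [Finset.sum_mul_sum, Finset.sum_comm]
    simp only [smul_mul_smul_comm]
    refine Finset.sum_congr rfl fun I _ => Finset.sum_congr rfl fun J _ => ?_
    rw [mul_comm]

theorem sum_smul_charge (A : Matrix (Fin C) (Fin C) ℝ) (Q : Matrix (Fin N) (Fin C) ℤ)
    {V : Type*} [AddCommMonoid V] [Module ℂ V] (X : Fin N → Fin N → V) :
    ∑ a, ∑ b, (A a b : ℂ) • ∑ I, ∑ J, ((Q I a : ℂ) * (Q J b : ℂ)) • X I J =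
      ∑ I, ∑ J, (((realCharge Q * A * (realCharge Q)ᵀ) I J : ℝ) : ℂ) • X I J := by
  have hc : ∀ I J, (((realCharge Q * A * (realCharge Q)ᵀ) I J : ℝ) : ℂ) =
      ∑ a, ∑ b, (A a b : ℂ) * ((Q I a : ℂ) * (Q J b : ℂ)) := fun I J => by
    simp only [Matrix.mul_apply, Matrix.transpose_apply, realCharge, Matrix.map_apply,
      Finset.sum_mul]
    rw [Finset.sum_comm]
    push_cast
    refine Finset.sum_congr rfl fun a _ => Finset.sum_congr rfl fun b _ => ?_
    ring
  simp only [hc, Finset.sum_smul, Finset.smul_sum, smul_smul]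
  rw [Finset.sum_congr rfl fun a _ => Finset.sum_comm, Finset.sum_comm]
  refine Finset.sum_congr rfl fun I _ => ?_
  rw [Finset.sum_congr rfl fun a _ => Finset.sum_comm, Finset.sum_comm]

/-- The ordering depends only on mode numbers, so the charges factor out of the sums. All dependence
on Q is then through the projection onto its column space. -/
theorem sugawaraT_eq (Q : Matrix (Fin N) (Fin C) ℤ) (n : ℤ) :
    sugawaraT Q n = quadraticT (realCharge Q * levelInv Q * (realCharge Q)ᵀ) n := by
  have h : ∀ a b, (locSum fun m : ℤ => currentOrd Q a b m (n - m)) =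
      ∑ I, ∑ J, ((Q I a : ℂ) * (Q J b : ℂ)) • locSum fun m : ℤ => numberOrd I J m (n - m) :=
    fun a b => by
      simp only [currentOrd_eq]
      exact (HasLocSum.finset_sum _ fun I _ => HasLocSum.finset_sum _ fun J _ =>
        (hasLocSum_numberOrd I J n).smul _).locSum_eq
  simp only [sugawaraT, quadraticT, h, sum_smul_charge]

theorem gaugeCurrent_commutator (Q : Matrix (Fin N) (Fin C) ℤ) (a b : Fin C) (m n : ℤ) :
    gaugeCurrent Q a m * gaugeCurrent Q b n - gaugeCurrent Q b n * gaugeCurrent Q a m =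
      (if m + n = 0 then (m : ℂ) * ((level Q a b : ℝ) : ℂ) else 0) • (1 : Op N) := by
  have h : gaugeCurrent Q a m * gaugeCurrent Q b n - gaugeCurrent Q b n * gaugeCurrent Q a m =
      ∑ I, ∑ J, ((Q I a : ℂ) * (Q J b : ℂ)) •
        (current I m * current J n - current J n * current I m) := by
    have h1 : gaugeCurrent Q a m * gaugeCurrent Q b n =
        ∑ I, ∑ J, ((Q I a : ℂ) * (Q J b : ℂ)) • (current I m * current J n) := by
      simp only [gaugeCurrent, Finset.sum_mul_sum, smul_mul_smul_comm]
    have h2 : gaugeCurrent Q b n * gaugeCurrent Q a m =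
        ∑ I, ∑ J, ((Q I a : ℂ) * (Q J b : ℂ)) • (current J n * current I m) := by
      simp only [gaugeCurrent, Finset.sum_mul_sum, smul_mul_smul_comm]
      rw [Finset.sum_comm]
      refine Finset.sum_congr rfl fun I _ => Finset.sum_congr rfl fun J _ => ?_
      rw [mul_comm]
    simp only [h1, h2, smul_sub, Finset.sum_sub_distrib]
  rw [h]
  simp only [current_commutator]
  by_cases hmn : m + n = 0
  · simp only [hmn, and_true, if_true, smul_smul]
    simp only [level, Matrix.mul_apply, Matrix.transpose_apply, realCharge, Matrix.map_apply,
      mul_ite, mul_zero, ite_smul, zero_smul, Finset.sum_ite_eq, Finset.mem_univ, if_true]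
    rw [← Finset.sum_smul]
    congr 1
    push_cast
    rw [Finset.mul_sum]
    exact Finset.sum_congr rfl fun I _ => by ring
  · simp [hmn]

theorem conformallyEmbeds_iff (Q : Matrix (Fin N) (Fin C) ℤ) :
    ConformallyEmbeds Q ↔ ∀ n : ℤ, sugawaraT Q n = fermionT N n :=
  and_iff_right (gaugeCurrent_commutator Q)

/-! ### Central charges -/

theorem fockInner_vacuum_self : fockInner (vacuum N) (vacuum N) = 1 := by
  rw [vacuum, fockInner_ket_left]; simp [ket]

theorem current_one_mul_vacuum (I J : Fin N) :
    current I 1 (current J (-1) (vacuum N)) = if I = J then vacuum N else 0 := by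
  have h := congrArg (fun X : Op N => X (vacuum N)) (current_commutator I J 1 (-1))
  simp only [LinearMap.sub_apply, Module.End.mul_apply, current_vacuum I zero_le_one, map_zero,
    sub_zero, LinearMap.smul_apply, Module.End.one_apply] at h
  rw [h]
  split_ifs <;> simp_all

theorem quadraticT_neg_two_vacuum (P : Matrix (Fin N) (Fin N) ℝ) :
    quadraticT P (-2) (vacuum N) = (1 / 2 : ℂ) • ∑ I, ∑ J, (P I J : ℂ) •
      current I (-1) (current J (-1) (vacuum N)) := by
  simp only [quadraticT, LinearMap.smul_apply, LinearMap.sum_apply]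
  congr 1
  refine Finset.sum_congr rfl fun I _ => Finset.sum_congr rfl fun J _ => ?_
  -- The mode numbers add up to -2, so unless both are -1 the larger one is nonnegative and its
  -- current kills the vacuum.
  rw [(hasLocSum_numberOrd I J (-2) _).2, finsum_eq_single _ (-1)]
  · simp [numberOrd]
  · intro m hm
    simp only [numberOrd]
    split_ifs
    · rw [Module.End.mul_apply, current_vacuum J (by omega), map_zero]
    · rw [Module.End.mul_apply, current_vacuum I (by omega), map_zero]

theorem current_one_quadraticT_vacuum {P : Matrix (Fin N) (Fin N) ℝ} (hP : Pᵀ = P) (I : Fin N) :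
    current I 1 (quadraticT P (-2) (vacuum N)) = ∑ J, (P I J : ℂ) • current J (-1) (vacuum N) := by
  have h : ∀ J K : Fin N, current I 1 (current J (-1) (current K (-1) (vacuum N))) =
      (if I = J then current K (-1) (vacuum N) else 0) +
        if I = K then current J (-1) (vacuum N) else 0 := fun J K => by
    have h := congrArg (fun X : Op N => X (current K (-1) (vacuum N)))
      (current_commutator I J 1 (-1))
    simp only [LinearMap.sub_apply, Module.End.mul_apply, LinearMap.smul_apply,
      Module.End.one_apply, current_one_mul_vacuum] at h
    rw [sub_eq_iff_eq_add.mp h]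
    split_ifs <;> simp_all
  have hs : ∀ J, P J I = P I J := fun J => congrFun (congrFun hP I) J
  simp only [quadraticT_neg_two_vacuum, map_smul, map_sum, h, smul_add, Finset.sum_add_distrib,
    smul_ite, smul_zero, Finset.sum_ite_eq, Finset.mem_univ, if_true, hs]
  rw [Finset.sum_comm]
  simp only [Finset.sum_ite_eq, Finset.mem_univ, if_true]
  rw [← smul_add, ← two_smul ℂ, smul_smul]
  norm_num

/-- By adjointness the two-point function is the squared norm of L_{-2}|0⟩. Each of the two
contractions of j_1 with this state gives the same term, which absorbs one factor 1/2; the other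
cancels the 2 in the definition of c. -/
theorem centralCharge_quadraticT {P : Matrix (Fin N) (Fin N) ℝ} (hP : Pᵀ = P) :
    centralCharge (quadraticT P) = ((P * P).trace : ℂ) := by
  have hadj := isAdjoint_quadraticT hP 2
  rw [centralCharge, hadj]
  nth_rewrite 1 [quadraticT_neg_two_vacuum]
  rw [fockInner_smul_left, fockInner_sum_left]
  simp only [fockInner_sum_left, fockInner_smul_left]
  have h : ∀ I J, fockInner (current I (-1) (current J (-1) (vacuum N)))
      (quadraticT P (-2) (vacuum N)) = P I J := fun I J => by
    rw [← isAdjoint_current I 1, ← isAdjoint_current J 1, current_one_quadraticT_vacuum hP]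
    simp only [map_sum, map_smul, current_one_mul_vacuum, smul_ite, smul_zero, Finset.sum_ite_eq,
      Finset.mem_univ, if_true, fockInner_smul_right, fockInner_vacuum_self, mul_one]
  simp only [h, Complex.conj_ofReal]
  have hs : ∀ I J, P J I = P I J := fun I J => congrFun (congrFun hP I) J
  simp only [Matrix.trace, Matrix.diag, Matrix.mul_apply]
  push_cast
  rw [← mul_assoc]
  simp [map_ofNat]
  exact Finset.sum_congr rfl fun I _ => Finset.sum_congr rfl fun J _ => by rw [hs I J]

theorem centralCharge_fermionT : centralCharge (fermionT N) = N := by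
  rw [← funext quadraticT_one_eq, centralCharge_quadraticT Matrix.transpose_one]
  simp

theorem centralCharge_sugawaraT (Q : Matrix (Fin N) (Fin C) ℤ) :
    centralCharge (sugawaraT Q) = ((realCharge Q).rank : ℂ) := by
  rw [funext (sugawaraT_eq Q), centralCharge_quadraticT]
  · rw [← Complex.ofReal_natCast, ← trace_levelInv_mul_level, level]
    congr 1
    rw [Matrix.mul_assoc (realCharge Q), Matrix.mul_assoc (realCharge Q), Matrix.trace_mul_comm]
    simp only [Matrix.mul_assoc]
  · simp [levelInv_transpose, Matrix.mul_assoc]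

/-- Necessity needs only the central charges; sufficiency is bosonization with P = 1. -/
theorem conformallyEmbeds_iff_rank (Q : Matrix (Fin N) (Fin N) ℤ) :
    ConformallyEmbeds Q ↔ (realCharge Q).rank = N := by
  rw [conformallyEmbeds_iff]
  constructor
  · intro h
    have := centralCharge_sugawaraT Q
    rw [funext h, centralCharge_fermionT] at this
    exact_mod_cast this.symm
  · intro h n
    rw [sugawaraT_eq, realCharge_mul_levelInv_mul h, quadraticT_one_eq]

/-! ### The longitudinal momentum -/

/-- The momentum of the occupation-number state `S`. -/
def momentum (S : Finset (Mode N)) : ℝ := ∑ m ∈ S, |((ofLex m).2 : ℝ) + 1 / 2|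

theorem fermionT_zero_mul_create (m : Mode N) :
    fermionT N 0 * create m =
      create m * fermionT N 0 + ((|((ofLex m).2 : ℝ) + 1 / 2| : ℝ) : ℂ) • create m := by
  obtain ⟨I, k, rfl⟩ : ∃ I k, m = toLex (I, k) := ⟨(ofLex m).1, (ofLex m).2, rfl⟩
  rw [create_eq, ofLex_toLex]
  split_ifs with hk
  · have : (0 : ℝ) ≤ k := by exact_mod_cast hk
    rw [fermionT_mul_psiDag, abs_of_nonneg (by positivity), sub_zero]
    push_cast
    simp
  · have : (k : ℝ) ≤ -1 := by exact_mod_cast (by omega : k ≤ -1)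
    rw [fermionT_mul_psi, abs_of_nonpos (by linarith), add_zero, sub_eq_add_neg, ← neg_smul]
    push_cast
    simp

theorem fermionT_zero_ket (S : Finset (Mode N)) :
    fermionT N 0 (ket S) = (momentum S : ℂ) • ket S := by
  induction S using Finset.induction_on with
  | empty =>
    rw [momentum, Finset.sum_empty, Complex.ofReal_zero, zero_smul]
    exact fermionT_vacuum le_rfl
  | insert m S hm ih =>
    rw [ket_insert hm, map_smul, ← Module.End.mul_apply, fermionT_zero_mul_create,
      LinearMap.add_apply, Module.End.mul_apply, ih, map_smul, LinearMap.smul_apply, ← add_smul,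
      smul_comm, momentum, momentum, Finset.sum_insert hm, ← Complex.ofReal_add, add_comm]

theorem fermionT_zero_apply (Ψ : Fock N) (S : Finset (Mode N)) :
    fermionT N 0 Ψ S = momentum S * Ψ S := by
  have h := isAdjoint_fermionT (N := N) 0
  rw [neg_zero] at h
  rw [← fockInner_ket_left, h, fermionT_zero_ket, fockInner_smul_left, Complex.conj_ofReal,
    fockInner_ket_left]

theorem momentum_nonneg (S : Finset (Mode N)) : 0 ≤ momentum S :=
  Finset.sum_nonneg fun _ _ => abs_nonneg _

theorem momentum_eq_zero {S : Finset (Mode N)} (h : momentum S = 0) : S = ∅ := by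
  by_contra hS
  obtain ⟨m, hm⟩ := Finset.nonempty_of_ne_empty hS
  have h0 := (Finset.sum_eq_zero_iff_of_nonneg fun _ _ => abs_nonneg _).mp h m hm
  rw [abs_eq_zero] at h0
  have : (2 * (ofLex m).2 + 1 : ℝ) = 0 := by linarith
  have : 2 * (ofLex m).2 + 1 = 0 := by exact_mod_cast this
  omega

theorem fermionT_zero_mul_current (I : Fin N) (n : ℤ) :
    fermionT N 0 * current I n - current I n * fermionT N 0 = -((n : ℂ) • current I n) := by
  have h := hasLocSum_current I n
  refine ((h.mul_left (fermionT N 0)).sub (h.mul_right (fermionT N 0))).unique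
    ((h.smul (n : ℂ)).neg.congr fun k => ?_)
  have e : fermionT N 0 * (psiDag I k * psi I (k + n)) =
      psiDag I k * psi I (k + n) * fermionT N 0 - (n : ℂ) • (psiDag I k * psi I (k + n)) := by
    rw [← mul_assoc, fermionT_mul_psiDag, add_mul, mul_assoc, fermionT_mul_psi, mul_sub,
      smul_mul_assoc, mul_smul_comm, Int.cast_zero, zero_div, sub_zero, sub_zero, add_zero,
      add_zero, mul_assoc, sub_add, ← sub_smul]
    congr 2
    push_cast; ring
  rw [normalOrd_eq, mul_sub, sub_mul, e]
  -- The normal-ordering constant occurs only for `n = 0`, where the right-hand side vanishes.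
  by_cases hn : n = 0
  · subst hn
    split_ifs <;> simp
  · rw [if_neg (by omega)]
    simp

theorem fermionT_zero_current {Ψ : Fock N} {p : ℝ} (h : fermionT N 0 Ψ = (p : ℂ) • Ψ) (I : Fin N)
    (n : ℤ) : fermionT N 0 (current I n Ψ) = ((p - n : ℝ) : ℂ) • current I n Ψ := by
  have e := congrArg (fun X : Op N => X Ψ) (fermionT_zero_mul_current I n)
  simp only [LinearMap.sub_apply, Module.End.mul_apply, h, LinearMap.neg_apply,
    LinearMap.smul_apply, map_smul] at e
  rw [sub_eq_iff_eq_add.mp e]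
  push_cast
  rw [sub_smul]
  abel

theorem eq_zero_of_momentum_neg {Ψ : Fock N} {p : ℝ} (h : fermionT N 0 Ψ = (p : ℂ) • Ψ)
    (hp : p < 0) : Ψ = 0 := by
  ext S
  have e := DFunLike.congr_fun h S
  rw [fermionT_zero_apply, Finsupp.smul_apply, smul_eq_mul] at e
  by_contra hS
  have := mul_right_cancel₀ hS e
  have : momentum S = p := by exact_mod_cast this
  linarith [momentum_nonneg S]

/-- The projection to the states of momentum `p`. -/
def momentumProj (p : ℝ) : Op N where
  toFun := Finsupp.filter fun S => momentum S = p
  map_add' _ _ := Finsupp.filter_add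
  map_smul' _ _ := Finsupp.filter_smul

theorem momentumProj_apply (p : ℝ) (Ψ : Fock N) (S : Finset (Mode N)) :
    momentumProj p Ψ S = if momentum S = p then Ψ S else 0 := by
  classical
  exact Finsupp.filter_apply _ _ _

theorem fermionT_zero_momentumProj (p : ℝ) (Ψ : Fock N) :
    fermionT N 0 (momentumProj p Ψ) = (p : ℂ) • momentumProj p Ψ := by
  ext S
  rw [fermionT_zero_apply, Finsupp.smul_apply, momentumProj_apply, smul_eq_mul]
  split_ifs with h <;> simp [h]

theorem momentumProj_of_eigen {Ψ : Fock N} {q : ℝ} (h : fermionT N 0 Ψ = (q : ℂ) • Ψ) (p : ℝ) :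
    momentumProj p Ψ = if q = p then Ψ else 0 := by
  ext S
  rw [momentumProj_apply]
  have e := DFunLike.congr_fun h S
  rw [fermionT_zero_apply, Finsupp.smul_apply, smul_eq_mul] at e
  by_cases hS : Ψ S = 0
  · split_ifs <;> simp [hS]
  · have hq : momentum S = q := by exact_mod_cast mul_right_cancel₀ hS e
    rw [hq]
    split_ifs <;> simp

theorem momentumProj_commute {X : Op N} (h : fermionT N 0 * X = X * fermionT N 0) (p : ℝ)
    (Ψ : Fock N) : momentumProj p (X Ψ) = X (momentumProj p Ψ) := by
  suffices hX : momentumProj p * X = X * momentumProj p from congrArg (fun Y : Op N => Y Ψ) hX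
  refine op_ext fun S => ?_
  have e : fermionT N 0 (X (ket S)) = (momentum S : ℂ) • X (ket S) := by
    rw [← Module.End.mul_apply, h, Module.End.mul_apply, fermionT_zero_ket, map_smul]
  rw [Module.End.mul_apply, Module.End.mul_apply, momentumProj_of_eigen e,
    momentumProj_of_eigen (fermionT_zero_ket S)]
  split_ifs <;> simp

theorem sum_momentumProj (Ψ : Fock N) {s : Finset ℝ} (hs : Ψ.support.image momentum ⊆ s) :
    ∑ p ∈ s, momentumProj p Ψ = Ψ := by
  ext S
  rw [Finsupp.finsetSum_apply]
  simp only [momentumProj_apply, Finset.sum_ite_eq]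
  split_ifs with h
  · rfl
  · by_contra hS
    exact h (hs (Finset.mem_image_of_mem _ (Finsupp.mem_support_iff.mpr (Ne.symm hS))))

theorem isAdjoint_momentumProj (p : ℝ) : IsAdjoint (momentumProj (N := N) p) (momentumProj p) := by
  refine isAdjoint_of_ket fun T S => ?_
  rw [momentumProj_of_eigen (fermionT_zero_ket S), momentumProj_of_eigen (fermionT_zero_ket T)]
  by_cases hTS : T = S
  · subst hTS
    split_ifs <;> simp [fockInner_zero_left, fockInner_zero_right]
  · have h : fockInner (ket T) (ket S) = 0 := by
      rw [fockInner_ket_left, ket, Finsupp.single_eq_of_ne hTS]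
    split_ifs <;> simp [fockInner_zero_left, fockInner_zero_right, h]

theorem momentumProj_momentumProj (p : ℝ) (Ψ : Fock N) :
    momentumProj p (momentumProj p Ψ) = momentumProj p Ψ := by
  ext S
  simp only [momentumProj_apply]
  split_ifs <;> rfl

/-- Expectation values decompose over the momentum sectors. -/
theorem fockInner_eq_sum_momentumProj {X : Op N} (h : fermionT N 0 * X = X * fermionT N 0)
    (Ψ : Fock N) : fockInner Ψ (X Ψ) = ∑ p ∈ Ψ.support.image momentum,
      fockInner (momentumProj p Ψ) (X (momentumProj p Ψ)) := by
  conv_lhs => rw [← sum_momentumProj Ψ subset_rfl]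
  conv_lhs => enter [2]; rw [sum_momentumProj Ψ subset_rfl]
  rw [fockInner_sum_left]
  refine Finset.sum_congr rfl fun p _ => ?_
  rw [← momentumProj_commute h, isAdjoint_momentumProj p, momentumProj_momentumProj]

/-! ### Expectation values -/

theorem HasLocSum.hasSum_fockInner {ι : Type} {A : ι → Op N} {X : Op N} (h : HasLocSum A X)
    (Φ Ψ : Fock N) : HasSum (fun i => (fockInner Φ (A i Ψ)).re) (fockInner Φ (X Ψ)).re := by
  rw [(h Ψ).2, fockInner_finsum_right Φ (h Ψ).1]
  have hf : (Function.support fun i => fockInner Φ (A i Ψ)).Finite :=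
    (h Ψ).1.subset fun i hi h0 => hi (by
      change fockInner Φ (A i Ψ) = 0
      rw [show A i Ψ = 0 from h0, fockInner_zero_right])
  rw [← tsum_eq_finsum (L := .unconditional ι) hf]
  have hs : Summable fun i => fockInner Φ (A i Ψ) := summable_of_hasFiniteSupport hf
  exact Complex.hasSum_re hs.hasSum

/-- Bosonization turns P⁺ into a sum of j_{-|m|} j_{|m|}, whose expectation values are squared
norms. -/
theorem hasSum_fermionT_zero (Ψ : Fock N) :
    HasSum (fun m : ℤ => 1 / 2 * ∑ I, (fockInner (current I |m| Ψ) (current I |m| Ψ)).re)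
      (fockInner Ψ (fermionT N 0 Ψ)).re := by
  have h := (HasLocSum.finset_sum Finset.univ fun (I : Fin N) _ =>
    hasLocSum_numberOrd I I 0).smul (1 / 2)
  rw [← quadraticT_one, quadraticT_one_eq] at h
  convert h.hasSum_fockInner Ψ Ψ using 2 with m
  have e : ∀ I, fockInner Ψ (numberOrd I I m (0 - m) Ψ) =
      fockInner (current I |m| Ψ) (current I |m| Ψ) := fun I => by
    unfold numberOrd
    split_ifs with hm
    · rw [abs_of_nonpos (by omega), zero_sub, Module.End.mul_apply, isAdjoint_current]
    · rw [abs_of_pos (by omega), zero_sub, Module.End.mul_apply, isAdjoint_current, neg_neg]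
  rw [LinearMap.smul_apply, LinearMap.sum_apply, fockInner_smul_right, fockInner_sum_right,
    Finset.sum_congr rfl fun I _ => e I, ← Complex.ofReal_one, ← Complex.ofReal_ofNat,
    ← Complex.ofReal_div, Complex.re_ofReal_mul, Complex.re_sum]

/-- Each positive mode occurs twice, for m and -m, which cancels the factor 1/2. -/
theorem hasSum_nat_of_hasSum_int_abs {f : ℤ → ℝ} (hf : (Function.support fun m : ℤ => f |m|).Finite)
    (h0 : f 0 = 0) {s : ℝ} (h : HasSum (fun m : ℤ => 1 / 2 * f |m|) s) :
    HasSum (fun n : ℕ => f (n + 1)) s := by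
  have hfin : (Function.support fun n : ℕ => f (n + 1)).Finite := by
    refine (hf.preimage (f := fun n : ℕ => (n : ℤ) + 1)
      (fun a _ b _ hab => by simpa using hab)).subset fun n hn => ?_
    rw [Set.mem_preimage, Function.mem_support, abs_of_nonneg (by positivity)]
    exact hn
  have habs : (fun n : ℕ => f |(n : ℤ) + 1|) = fun n : ℕ => f (n + 1) :=
    funext fun n => by rw [abs_of_nonneg (by positivity)]
  have hs : Summable fun n : ℕ => f (n + 1) := summable_of_hasFiniteSupport hfin
  replace hs := hs.hasSum
  set t := ∑' n : ℕ, f (n + 1)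
  have h1 : HasSum (fun n : ℕ => 1 / 2 * f |(n : ℤ)|) (1 / 2 * t) := by
    refine HasSum.mul_left _ ?_
    rw [← hasSum_nat_add_iff' 1]
    rw [← habs] at hs
    simpa [h0] using hs
  have h2 : HasSum (fun n : ℕ => 1 / 2 * f |(-((n : ℤ) + 1))|) (1 / 2 * t) := by
    refine HasSum.mul_left _ ?_
    simp only [abs_neg]
    rwa [habs]
  have h3 := HasSum.of_nat_of_neg_add_one (f := fun m : ℤ => 1 / 2 * f |m|) h1 h2
  rw [h.unique h3]
  convert hs using 1
  ring

theorem isAdjoint_gaugeCurrent (Q : Matrix (Fin N) (Fin C) ℤ) (a : Fin C) (n : ℤ) :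
    IsAdjoint (gaugeCurrent Q a n) (gaugeCurrent Q a (-n)) :=
  IsAdjoint.sum _ fun I _ => (isAdjoint_current I n).smul_real (by simp)

/-- The contribution of the photon modes of momentum `n + 1` to the light-cone energy. -/
def lightconeTerm (κ : Matrix (Fin C) (Fin C) ℝ) (Q : Matrix (Fin N) (Fin C) ℤ) (n : ℕ) : Op N :=
  (1 / ((n : ℂ) + 1) ^ 2) • ∑ a : Fin C, ∑ b : Fin C,
    ((κ⁻¹ a b : ℝ) : ℂ) • (gaugeCurrent Q a (-((n : ℤ) + 1)) * gaugeCurrent Q b ((n : ℤ) + 1))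

theorem hasLocSum_lightconeEnergy (κ : Matrix (Fin C) (Fin C) ℝ) (Q : Matrix (Fin N) (Fin C) ℤ) :
    HasLocSum (fun n => (1 / (2 * (Real.pi : ℂ))) • lightconeTerm κ Q n) (lightconeEnergy κ Q) :=
  (hasLocSum_locSum (A := lightconeTerm κ Q) (lightcone_locallyFinite κ Q)).smul _

theorem fockInner_lightconeTerm (κ : Matrix (Fin C) (Fin C) ℝ) (Q : Matrix (Fin N) (Fin C) ℤ)
    (n : ℕ) (Ψ : Fock N) : (fockInner Ψ (lightconeTerm κ Q n Ψ)).re =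
      1 / ((n : ℝ) + 1) ^ 2 * (∑ I, ∑ J,
        (((realCharge Q * κ⁻¹ * (realCharge Q)ᵀ) I J : ℝ) : ℂ) *
          fockInner (current I ((n : ℤ) + 1) Ψ) (current J ((n : ℤ) + 1) Ψ)).re := by
  have e : fockInner Ψ (lightconeTerm κ Q n Ψ) = ((1 / ((n : ℝ) + 1) ^ 2 : ℝ) : ℂ) *
      ∑ a, ∑ b, ((κ⁻¹ a b : ℝ) : ℂ) * fockInner (gaugeCurrent Q a ((n : ℤ) + 1) Ψ)
        (gaugeCurrent Q b ((n : ℤ) + 1) Ψ) := by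
    rw [lightconeTerm, LinearMap.smul_apply, fockInner_smul_right]
    congr 1
    · push_cast; rfl
    · simp only [LinearMap.sum_apply, LinearMap.smul_apply, Module.End.mul_apply,
        fockInner_sum_right, fockInner_smul_right]
      refine Finset.sum_congr rfl fun a _ => Finset.sum_congr rfl fun b _ => ?_
      rw [isAdjoint_gaugeCurrent, neg_neg]
  rw [e, Complex.re_ofReal_mul]
  congr 2
  have h := sum_smul_charge κ⁻¹ Q fun I J =>
    fockInner (current I ((n : ℤ) + 1) Ψ) (current J ((n : ℤ) + 1) Ψ)
  simp only [smul_eq_mul] at h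
  rw [← h]
  refine Finset.sum_congr rfl fun a _ => Finset.sum_congr rfl fun b _ => ?_
  congr 1
  simp only [gaugeCurrent, LinearMap.sum_apply, LinearMap.smul_apply, fockInner_sum_left,
    fockInner_sum_right, fockInner_smul_left, fockInner_smul_right, map_intCast, Finset.mul_sum,
    mul_assoc]
  rw [Finset.sum_comm]
  refine Finset.sum_congr rfl fun I _ => Finset.sum_congr rfl fun J _ => mul_left_comm _ _ _

theorem fermionT_zero_mul_lightconeEnergy (κ : Matrix (Fin C) (Fin C) ℝ)
    (Q : Matrix (Fin N) (Fin C) ℤ) :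
    fermionT N 0 * lightconeEnergy κ Q = lightconeEnergy κ Q * fermionT N 0 := by
  have hJ : ∀ a n, fermionT N 0 * gaugeCurrent Q a n =
      gaugeCurrent Q a n * fermionT N 0 - (n : ℂ) • gaugeCurrent Q a n := fun a n => by
    rw [eq_sub_iff_add_eq, ← sub_eq_zero]
    simp only [gaugeCurrent, Finset.mul_sum, Finset.sum_mul, Finset.smul_sum,
      ← Finset.sum_add_distrib, ← Finset.sum_sub_distrib]
    refine Finset.sum_eq_zero fun I _ => ?_
    rw [mul_smul_comm, smul_mul_assoc, smul_comm (n : ℂ), ← smul_add, ← smul_sub,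
      add_sub_right_comm, fermionT_zero_mul_current, neg_add_cancel, smul_zero]
  have h := hasLocSum_lightconeEnergy κ Q
  refine (h.mul_left _).unique ((h.mul_right _).congr fun n => ?_)
  unfold lightconeTerm
  simp only [smul_mul_assoc, mul_smul_comm, Finset.sum_mul, Finset.mul_sum]
  congr 2
  refine Finset.sum_congr rfl fun a _ => Finset.sum_congr rfl fun b _ => ?_
  rw [← mul_assoc (fermionT N 0), hJ, sub_mul, mul_assoc _ (fermionT N 0), hJ, mul_sub,
    smul_mul_assoc, mul_smul_comm, mul_assoc, sub_sub, ← add_smul]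
  push_cast
  simp

/-! ### Mass gap at full rank -/

theorem sum_diagonal_fockInner {k : ℕ} (U : Matrix (Fin k) (Fin k) ℝ) (d : Fin k → ℝ)
    (u : Fin k → Fock N) :
    ∑ I, ∑ J, (((U * Matrix.diagonal d * Uᵀ) I J : ℝ) : ℂ) * fockInner (u I) (u J) =
      ∑ i, (d i : ℂ) * fockInner (∑ I, (U I i : ℂ) • u I) (∑ J, (U J i : ℂ) • u J) := by
  have hU : ∀ I J, (U * Matrix.diagonal d * Uᵀ) I J = ∑ i, U I i * d i * U J i := fun I J => by
    simp only [Matrix.mul_apply (N := Uᵀ), Matrix.mul_diagonal, Matrix.transpose_apply]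
  simp only [hU, fockInner_sum_left, fockInner_sum_right, fockInner_smul_left,
    fockInner_smul_right, Complex.conj_ofReal, Complex.ofReal_sum, Complex.ofReal_mul,
    Finset.sum_mul, Finset.mul_sum]
  rw [Finset.sum_congr rfl fun I _ => Finset.sum_comm, Finset.sum_comm]
  refine Finset.sum_congr rfl fun i _ => ?_
  rw [Finset.sum_comm]
  exact Finset.sum_congr rfl fun J _ => Finset.sum_congr rfl fun I _ => by ring

/-- The constant is the smallest eigenvalue: a real orthogonal change of basis diagonalizes the form
also on tuples of Fock states and preserves the sum of squared norms. -/
theorem exists_le_of_posDef {k : ℕ} {A : Matrix (Fin k) (Fin k) ℝ} (hA : A.PosDef) :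
    ∃ c : ℝ, 0 < c ∧ ∀ u : Fin k → Fock N, c * ∑ I, (fockInner (u I) (u I)).re ≤
      (∑ I, ∑ J, (A I J : ℂ) * fockInner (u I) (u J)).re := by
  set lam := hA.isHermitian.eigenvalues
  obtain ⟨c, hc0, hc⟩ : ∃ c : ℝ, 0 < c ∧ ∀ i, c ≤ lam i := by
    rcases isEmpty_or_nonempty (Fin k) with h | h
    · exact ⟨1, one_pos, fun i => isEmptyElim i⟩
    · obtain ⟨i, hi⟩ := Finite.exists_min lam
      exact ⟨lam i, hA.eigenvalues_pos i, hi⟩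
  refine ⟨c, hc0, fun u => ?_⟩
  set U := (hA.isHermitian.eigenvectorUnitary : Matrix (Fin k) (Fin k) ℝ)
  have h1 := sum_diagonal_fockInner U (fun _ => 1) u
  have h2 := sum_diagonal_fockInner U lam u
  rw [← eq_eigenvectorUnitary_mul hA.isHermitian] at h2
  rw [Matrix.diagonal_one, Matrix.mul_one, eigenvectorUnitary_mul_transpose] at h1
  have h3 : ∑ I, (fockInner (u I) (u I)).re =
      ∑ i, (fockInner (∑ I, (U I i : ℂ) • u I) (∑ J, (U J i : ℂ) • u J)).re := by
    rw [← Complex.re_sum, ← Complex.re_sum]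
    congr 1
    simpa [Matrix.one_apply, apply_ite] using h1
  rw [h2, h3, Complex.re_sum, Finset.mul_sum]
  refine Finset.sum_le_sum fun i _ => ?_
  rw [Complex.re_ofReal_mul]
  exact mul_le_mul_of_nonneg_right (hc i) (fockInner_self_nonneg _)

/-- An invertible Q allows each number charge to be recovered as a real combination of gauge
charges. -/
theorem current_zero_of_gaugeInvariant {Q : Matrix (Fin N) (Fin N) ℤ}
    (hQ : (realCharge Q).rank = N) {Ψ : Fock N} (h : GaugeInvariant Q Ψ) (I : Fin N) :
    current I 0 Ψ = 0 := by
  have hR : realCharge Q * (realCharge Q)⁻¹ = 1 :=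
    Matrix.mul_nonsing_inv _ ((Matrix.isUnit_iff_isUnit_det _).mp (isUnit_of_rank_eq hQ))
  have hc : ∀ J, ∑ a, (((realCharge Q)⁻¹ a I : ℝ) : ℂ) * (Q J a : ℂ) = if J = I then 1 else 0 :=
    fun J => by
    have e := congrFun (congrFun hR J) I
    rw [Matrix.mul_apply, Matrix.one_apply] at e
    rw [← Complex.ofReal_one, ← Complex.ofReal_zero, ← apply_ite, ← e, Complex.ofReal_sum]
    refine Finset.sum_congr rfl fun a _ => ?_
    simp [realCharge, mul_comm]
  have e : ∑ a, (((realCharge Q)⁻¹ a I : ℝ) : ℂ) • gaugeCurrent Q a 0 Ψ = current I 0 Ψ := by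
    simp only [gaugeCurrent, LinearMap.sum_apply, LinearMap.smul_apply, Finset.smul_sum, smul_smul]
    rw [Finset.sum_comm]
    simp only [← Finset.sum_smul, hc, ite_smul, one_smul, zero_smul, Finset.sum_ite_eq',
      Finset.mem_univ, if_true]
  rw [← e]
  exact Finset.sum_eq_zero fun a _ => by rw [h a, smul_zero]

theorem hasSum_momentum {Ψ : Fock N} {p : ℝ} (hΨ : fermionT N 0 Ψ = (p : ℂ) • Ψ)
    (h0 : ∀ I, current I 0 Ψ = 0) :
    HasSum (fun n : ℕ => ∑ I, (fockInner (current I ((n : ℤ) + 1) Ψ)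
      (current I ((n : ℤ) + 1) Ψ)).re) (p * (fockInner Ψ Ψ).re) := by
  have h := hasSum_fermionT_zero Ψ
  rw [hΨ, fockInner_smul_right, Complex.re_ofReal_mul] at h
  refine hasSum_nat_of_hasSum_int_abs
    (f := fun m => ∑ I, (fockInner (current I m Ψ) (current I m Ψ)).re) ?_ ?_ h
  -- A current of mode number above `p` would lower the momentum below zero, so it kills the state.
  · refine (Set.finite_Icc (-|⌈p⌉|) |⌈p⌉|).subset fun m hm => ?_
    by_contra hc
    refine hm (Finset.sum_eq_zero fun I _ => ?_)
    rw [eq_zero_of_momentum_neg (fermionT_zero_current hΨ I |m|), fockInner_zero_left,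
      Complex.zero_re]
    rw [Set.mem_Icc, ← abs_le, not_le] at hc
    have h1 : ⌈p⌉ < |m| := (le_abs_self _).trans_lt hc
    have h2 : (⌈p⌉ : ℝ) < (|m| : ℤ) := by exact_mod_cast h1
    linarith [Int.le_ceil p]
  · simp [h0, fockInner_zero_left]

/-- On gauge-invariant states of definite momentum, the squared mass is bounded below. -/
theorem lightconeEnergy_bound {κ : Matrix (Fin N) (Fin N) ℝ} {Q : Matrix (Fin N) (Fin N) ℤ}
    {c : ℝ} (hc0 : 0 ≤ c) (hc : ∀ u : Fin N → Fock N, c * ∑ I, (fockInner (u I) (u I)).re ≤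
      (∑ I, ∑ J, (((realCharge Q * κ⁻¹ * (realCharge Q)ᵀ) I J : ℝ) : ℂ) *
        fockInner (u I) (u J)).re) {Ψ : Fock N} {p : ℝ} (hp : 0 < p)
    (hΨ : fermionT N 0 Ψ = (p : ℂ) • Ψ) (h0 : ∀ I, current I 0 Ψ = 0) :
    c / Real.pi * (fockInner Ψ Ψ).re ≤ 2 * (p * (fockInner Ψ (lightconeEnergy κ Q Ψ)).re) := by
  -- The weight 1/n² is replaced by its smallest value 1/p² among the contributing modes, so that
  -- the momentum sum rule can be compared termwise with the energy.
  have h1 := (hasSum_momentum hΨ h0).mul_left (c / (2 * Real.pi * p ^ 2))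
  have h2 := (hasLocSum_lightconeEnergy κ Q).hasSum_fockInner Ψ Ψ
  have key := hasSum_le (fun n => ?_) h1 h2
  · have hpi := Real.pi_pos
    calc c / Real.pi * (fockInner Ψ Ψ).re
        = 2 * (p * (c / (2 * Real.pi * p ^ 2) * (p * (fockInner Ψ Ψ).re))) := by
          field_simp
      _ ≤ _ := by gcongr
  · have e : (1 / (2 * (Real.pi : ℂ))) = ((1 / (2 * Real.pi) : ℝ) : ℂ) := by push_cast; rfl
    rw [LinearMap.smul_apply, fockInner_smul_right, e, Complex.re_ofReal_mul,
      fockInner_lightconeTerm]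
    have hu := hc fun I => current I ((n : ℤ) + 1) Ψ
    set s := ∑ I, (fockInner (current I ((n : ℤ) + 1) Ψ) (current I ((n : ℤ) + 1) Ψ)).re with hs
    have hs0 : 0 ≤ s := Finset.sum_nonneg fun I _ => fockInner_self_nonneg _
    have hn : (0 : ℝ) < (n : ℝ) + 1 := by positivity
    have hpi := Real.pi_pos
    have hle : c * s / p ^ 2 ≤ 1 / ((n : ℝ) + 1) ^ 2 * (c * s) := by
      by_cases hpn : p < (n : ℝ) + 1
      · have : s = 0 := Finset.sum_eq_zero fun I _ => by
          rw [eq_zero_of_momentum_neg (fermionT_zero_current hΨ I ((n : ℤ) + 1)),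
            fockInner_zero_left, Complex.zero_re]
          push_cast
          linarith
        simp [this]
      · rw [div_eq_mul_one_div, mul_comm]
        have : ((n : ℝ) + 1) ≤ p := not_lt.mp hpn
        gcongr
    calc c / (2 * Real.pi * p ^ 2) * s = 1 / (2 * Real.pi) * (c * s / p ^ 2) := by field_simp
      _ ≤ _ := by gcongr; exact hle.trans (by gcongr)

theorem chiralGapped_of_rank {κ : Matrix (Fin N) (Fin N) ℝ} (hκ : κ.PosDef)
    {Q : Matrix (Fin N) (Fin N) ℤ} (hQ : (realCharge Q).rank = N) : ChiralGapped κ Q := by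
  have hM : (realCharge Q * κ⁻¹ * (realCharge Q)ᵀ).PosDef := by
    have := hκ.inv.mul_mul_conjTranspose_same (B := realCharge Q)
      (Matrix.vecMul_injective_of_isUnit (isUnit_of_rank_eq hQ))
    rwa [Matrix.conjTranspose_eq_transpose_of_trivial] at this
  obtain ⟨c, hc0, hc⟩ := exists_le_of_posDef (N := N) hM
  refine ⟨c / Real.pi, div_pos hc0 Real.pi_pos, fun Ψ hΨ hvac => ?_⟩
  have hcomm : fermionT N 0 * massSq κ Q = massSq κ Q * fermionT N 0 := by
    rw [massSq, longitudinalMomentum, mul_smul_comm, smul_mul_assoc, mul_assoc,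
      ← fermionT_zero_mul_lightconeEnergy]
  have hone : fermionT N 0 * 1 = 1 * fermionT N 0 := by rw [mul_one, one_mul]
  rw [fockInner_eq_sum_momentumProj hcomm]
  have h1 := fockInner_eq_sum_momentumProj hone Ψ
  rw [Module.End.one_apply] at h1
  rw [h1, Complex.re_sum, Complex.re_sum, Finset.mul_sum]
  refine Finset.sum_le_sum fun p _ => ?_
  rw [Module.End.one_apply]
  have hp := fermionT_zero_momentumProj p Ψ
  have hmass : (fockInner (momentumProj p Ψ) (massSq κ Q (momentumProj p Ψ))).re =
      2 * (p * (fockInner (momentumProj p Ψ) (lightconeEnergy κ Q (momentumProj p Ψ))).re) := by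
    rw [massSq, longitudinalMomentum, fermionT_zero_mul_lightconeEnergy, LinearMap.smul_apply,
      Module.End.mul_apply, hp, map_smul, fockInner_smul_right, fockInner_smul_right,
      ← Complex.ofReal_ofNat, Complex.re_ofReal_mul, Complex.re_ofReal_mul]
  rw [hmass]
  -- Only the vacuum has momentum zero, and `Ψ` is orthogonal to it.
  have hz : momentumProj p Ψ = 0 ∨ 0 < p := by
    by_contra! hcon
    obtain ⟨hne, hle⟩ := hcon
    apply hne
    ext S
    rw [momentumProj_apply]
    split_ifs with hS
    · have : momentum S = 0 := le_antisymm (hS.trans_le hle) (momentum_nonneg S)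
      rw [momentum_eq_zero this, ← fockInner_ket_left]
      exact hvac
    · rfl
  rcases hz with hz | hpos
  · simp [hz, fockInner_zero_left]
  · refine lightconeEnergy_bound hc0.le hc hpos hp fun I => ?_
    -- Charges conserve momentum, so every momentum component of `Ψ` is again neutral.
    have hI : fermionT N 0 * current I 0 = current I 0 * fermionT N 0 := by
      rw [← sub_eq_zero, fermionT_zero_mul_current]; simp
    rw [← momentumProj_commute hI, current_zero_of_gaugeInvariant hQ hΨ, map_zero]

/-! ### Massless states -/

theorem gaugeInvariant_vacuum (Q : Matrix (Fin N) (Fin C) ℤ) : GaugeInvariant Q (vacuum N) :=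
  fun a => by simp [gaugeCurrent, current_vacuum _ le_rfl]

theorem lightconeEnergy_eq_zero {κ : Matrix (Fin C) (Fin C) ℝ} {Q : Matrix (Fin N) (Fin C) ℤ}
    {Ψ : Fock N} (h : ∀ a (n : ℕ), gaugeCurrent Q a ((n : ℤ) + 1) Ψ = 0) :
    lightconeEnergy κ Q Ψ = 0 := by
  rw [(hasLocSum_lightconeEnergy κ Q Ψ).2]
  refine finsum_eq_zero_of_forall_eq_zero fun n => ?_
  simp [lightconeTerm, h]

theorem lightconeEnergy_vacuum (κ : Matrix (Fin C) (Fin C) ℝ) (Q : Matrix (Fin N) (Fin C) ℤ) :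
    lightconeEnergy κ Q (vacuum N) = 0 :=
  lightconeEnergy_eq_zero fun a n => by simp [gaugeCurrent, current_vacuum _ (show 0 ≤ (n : ℤ) + 1 by positivity)]

theorem massSq_eq_zero {κ : Matrix (Fin C) (Fin C) ℝ} {Q : Matrix (Fin N) (Fin C) ℤ}
    {Ψ : Fock N} (h : lightconeEnergy κ Q Ψ = 0) : massSq κ Q Ψ = 0 := by
  rw [massSq, LinearMap.smul_apply, Module.End.mul_apply, h, map_zero, smul_zero]

/-- Removing the vacuum component keeps a massless state gauge-invariant and massless; the gap then
forces the remainder to be zero. -/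
theorem not_hasMasslessState_of_chiralGapped {κ : Matrix (Fin C) (Fin C) ℝ}
    {Q : Matrix (Fin N) (Fin C) ℤ} (h : ChiralGapped κ Q) : ¬ HasMasslessState κ Q := by
  rintro ⟨Ψ, hΨ, hE, hne⟩
  obtain ⟨Δ, hΔ, hgap⟩ := h
  set c := fockInner (vacuum N) Ψ
  have h1 : GaugeInvariant Q (Ψ + (-c) • vacuum N) := fun a => by
    rw [map_add, map_smul, hΨ a, gaugeInvariant_vacuum Q a, smul_zero, add_zero]
  have h2 : fockInner (vacuum N) (Ψ + (-c) • vacuum N) = 0 := by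
    rw [fockInner_add_right, fockInner_smul_right, fockInner_vacuum_self, mul_one, add_neg_cancel]
  have h3 : massSq κ Q (Ψ + (-c) • vacuum N) = 0 := massSq_eq_zero (by
    rw [map_add, map_smul, hE, lightconeEnergy_vacuum, smul_zero, add_zero])
  have h4 := hgap _ h1 h2
  rw [h3, fockInner_zero_right, Complex.zero_re] at h4
  have h5 := eq_zero_of_fockInner_self_le (nonpos_of_mul_nonpos_right h4 hΔ)
  refine hne c ?_
  rw [neg_smul] at h5
  exact add_neg_eq_zero.mp h5

/-- A linear combination of currents neutral under the gauge group creates a massless state. -/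
theorem exists_massless {κ : Matrix (Fin N) (Fin N) ℝ} {Q : Matrix (Fin N) (Fin N) ℤ}
    (hQ : (realCharge Q).rank ≠ N) :
    ∃ Ψ : Fock N, GaugeInvariant Q Ψ ∧ lightconeEnergy κ Q Ψ = 0 ∧
      fockInner (vacuum N) Ψ = 0 ∧ ∀ c : ℂ, Ψ ≠ c • vacuum N := by
  have hdet : (realCharge Q).det = 0 := by
    by_contra hd
    have := Matrix.rank_of_isUnit (realCharge Q)
      ((Matrix.isUnit_iff_isUnit_det _).mpr (isUnit_iff_ne_zero.mpr hd))
    exact hQ (by simpa using this)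
  -- A left null vector of Q gives a current orthogonal to all gauge currents, so its contraction
  -- with each of them vanishes.
  obtain ⟨v, hv0, hv⟩ := Matrix.exists_vecMul_eq_zero_iff.mpr hdet
  have hcur : ∀ I J (n : ℤ), 0 ≤ n → current I n (current J (-1) (vacuum N)) =
      (if I = J ∧ n = 1 then (1 : ℂ) else 0) • vacuum N := fun I J n hn => by
    by_cases h1 : n = 1
    · subst h1
      rw [current_one_mul_vacuum]
      split_ifs <;> simp_all
    · rw [← Module.End.mul_apply, current_mul_comm (by omega), Module.End.mul_apply,
        current_vacuum I hn, map_zero]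
      simp [h1]
  have hgauge : ∀ a (n : ℤ), 0 ≤ n →
      gaugeCurrent Q a n (∑ J, (v J : ℂ) • current J (-1) (vacuum N)) = 0 := fun a n hn => by
    have e := congrArg ((↑) : ℝ → ℂ) (congrFun hv a)
    simp only [Matrix.vecMul, dotProduct, realCharge, Matrix.map_apply, Pi.zero_apply,
      Complex.ofReal_sum, Complex.ofReal_mul, Complex.ofReal_intCast, Complex.ofReal_zero] at e
    simp only [gaugeCurrent, LinearMap.sum_apply, LinearMap.smul_apply, map_sum, map_smul,
      hcur _ _ _ hn]
    by_cases h1 : n = 1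
    · simp only [h1, and_true, ite_smul, one_smul, zero_smul, smul_ite, smul_zero,
        Finset.sum_ite_eq', Finset.mem_univ, if_true, smul_smul, ← Finset.sum_smul]
      rw [e, zero_smul]
    · simp [h1]
  refine ⟨∑ J, (v J : ℂ) • current J (-1) (vacuum N), fun a => hgauge a 0 le_rfl,
    lightconeEnergy_eq_zero fun a n => hgauge a _ (by positivity), ?_, fun c hc => ?_⟩
  · rw [fockInner_sum_right]
    refine Finset.sum_eq_zero fun J _ => ?_
    rw [fockInner_smul_right, isAdjoint_current, neg_neg, current_vacuum J zero_le_one,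
      fockInner_zero_left, mul_zero]
  · apply hv0
    funext I
    -- Applying j^I_1 reads off the coefficient `v I`, while it annihilates any multiple of the
    -- vacuum.
    have e := congrArg (fun Φ => fockInner (vacuum N) (current I 1 Φ)) hc
    simp only [map_sum, map_smul, current_one_mul_vacuum, current_vacuum I zero_le_one, smul_zero,
      fockInner_zero_right, smul_ite, Finset.sum_ite_eq, Finset.mem_univ, if_true,
      fockInner_smul_right, fockInner_vacuum_self, mul_one] at e
    exact_mod_cast e

theorem not_hasMasslessState_iff {κ : Matrix (Fin N) (Fin N) ℝ} (hκ : κ.PosDef)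
    (Q : Matrix (Fin N) (Fin N) ℤ) : ¬ HasMasslessState κ Q ↔ (realCharge Q).rank = N := by
  refine ⟨fun h => ?_, fun h => not_hasMasslessState_of_chiralGapped (chiralGapped_of_rank hκ h)⟩
  by_contra hQ
  obtain ⟨Ψ, h1, h2, -, h3⟩ := exists_massless (κ := κ) hQ
  exact h ⟨Ψ, h1, h2, h3⟩

theorem chiralGapped_iff {κ : Matrix (Fin N) (Fin N) ℝ} (hκ : κ.PosDef)
    (Q : Matrix (Fin N) (Fin N) ℤ) : ChiralGapped κ Q ↔ (realCharge Q).rank = N :=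
  ⟨fun h => (not_hasMasslessState_iff hκ Q).mp (not_hasMasslessState_of_chiralGapped h),
    chiralGapped_of_rank hκ⟩

/-- Over the reals the Gram matrix QᵗQ has the same rank as Q, and anomaly cancellation equates the
Gram matrices. -/
theorem rank_eq_of_anomaly_free {Ql Qr : Matrix (Fin N) (Fin C) ℤ} (h : Qlᵀ * Ql = Qrᵀ * Qr) :
    (realCharge Ql).rank = (realCharge Qr).rank := by
  have hK : ∀ Q : Matrix (Fin N) (Fin C) ℤ, level Q = (Qᵀ * Q).map fun z : ℤ => (z : ℝ) :=
    fun Q => by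
    ext a b
    simp [level, realCharge, Matrix.mul_apply]
  rw [← rank_level, ← rank_level, hK, hK, h]

end QED

end

/-! ### The equivalences for non-chiral and chiral QED -/

theorem mainTheorem5 (N : ℕ) (κ : Matrix (Fin N) (Fin N) ℝ) (hκ : κ.PosDef) :
    -- non-chiral QED with square charge matrix `Q`
    (∀ Q : Matrix (Fin N) (Fin N) ℤ,
      (QED.Gapped κ Q Q ↔ (QED.realCharge Q).rank = N) ∧
      (¬ QED.HasMasslessState κ Q ↔ (QED.realCharge Q).rank = N) ∧
      (QED.ConformallyEmbeds Q ↔ (QED.realCharge Q).rank = N) ∧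
      QED.centralCharge (QED.fermionT N) = (N : ℂ) ∧
      QED.centralCharge (QED.sugawaraT Q) = ((QED.realCharge Q).rank : ℂ)) ∧
    -- chiral QED with square charge matrices `Ql`, `Qr` and cancelled gauge anomaly
    (∀ Ql Qr : Matrix (Fin N) (Fin N) ℤ, Qlᵀ * Ql = Qrᵀ * Qr →
      (QED.realCharge Ql).rank = (QED.realCharge Qr).rank ∧
      (QED.Gapped κ Ql Qr ↔
        (QED.realCharge Ql).rank = N ∧ (QED.realCharge Qr).rank = N) ∧
      (¬ QED.HasMasslessState κ Ql ∧ ¬ QED.HasMasslessState κ Qr ↔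
        (QED.realCharge Ql).rank = N ∧ (QED.realCharge Qr).rank = N) ∧
      (QED.ConformallyEmbeds Ql ∧ QED.ConformallyEmbeds Qr ↔
        (QED.realCharge Ql).rank = N ∧ (QED.realCharge Qr).rank = N)) := by
  refine ⟨fun Q => ⟨?_, QED.not_hasMasslessState_iff hκ Q, QED.conformallyEmbeds_iff_rank Q,
    QED.centralCharge_fermionT, QED.centralCharge_sugawaraT Q⟩, fun Ql Qr h =>
    ⟨QED.rank_eq_of_anomaly_free h, ?_, ?_, ?_⟩⟩
  · rw [QED.Gapped, and_self, QED.chiralGapped_iff hκ]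
  · rw [QED.Gapped, QED.chiralGapped_iff hκ, QED.chiralGapped_iff hκ]
  · rw [QED.not_hasMasslessState_iff hκ, QED.not_hasMasslessState_iff hκ]
  · rw [QED.conformallyEmbeds_iff_rank, QED.conformallyEmbeds_iff_rank]
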